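/- \textbf{Setting.} Let $S$ be a compact Hausdorff space. Let $L_H$ be a first-order language (of the home sort $H$) with at most countably many function and constant symbols and arbitrarily many relation symbols, and let $F$ be a set of symbols of sort $H^n\times S^m\to S$ ($n,m\ge 0$). A standard structure $\langle M,S\rangle$ consists of an $L_H$-structure $M$ and, for every $g\in F$, an equicontinuous function $g:M^n\times S^m\to S$: for every closed neighbourhood $D$ of the diagonal of $S^2$ there is an open neighbourhood $E$ of the diagonal of $S^m\times S^m$ such that $(g(a,s),g(a,t))\in D$ for all $a\in M^n$ and $(s,t)\in E$. Terms of sort $S$ are built from variables of sort $S$, symbols for all continuous functions $S^m\to S$, and the symbols of $F$ applied to $L_H$-terms and terms of sort $S$. Positive formulas are built from first-order $L_H$-formulas and from formulas $t\in C$ ($t$ a $k$-tuple of terms of sort $S$, $C\subseteq S^k$ compact) by $\wedge,\vee$ and the quantifiers $\forall,\exists$ over both sorts; a positive formula is continuous if no $L_H$-formula occurs in it. $F^c$ is the set of continuous formulas. Write $\varphi'>\varphi$ if $\varphi'$ is obtained by replacing each atomic formula $t\in C$ in $\varphi$ by $t\in C'$ for some compact neighbourhood $C'$ of $C$. Let $U$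 be a standard structure that is a large positively saturated ``monster'': for some uncountable cardinal $\kappa$, $U$ realizes every set of positive formulas, in finitely many free variables and with fewer than $\kappa$ parameters from $U$, that is finitely satisfied in $U$ (for instance, $\kappa=|U|$ with $U$ uncountable). Let $T$ be the set of positive sentences true in $U$. $F^c$ is separable if there is a countable set $\mathcal H$ of continuous formulas such that for all continuous $\varphi(x)$ ($x$ a finite tuple of variables of sort $H$) and all $\varphi'>\varphi$ there is $\psi(x)\in\mathcal H$ such that $\varphi\to\psi\to\varphi'$ holds in every standard structure that models $T$. For $\varepsilon=(\tau,D)$, where $\tau(x,z)=(\tau_1,\dots,\tau_k)$ is a finite tuple of terms of sort $S$ with variables of sort $H$ only, and $D$ is a compact neighbourhood of the diagonal of $S^2$, write $x\sim_\varepsilon y$ if $(\tau_i(x,z),\tau_i(y,z))\in D$ for all $i$ and all tuples $z$ in $U$. For $A\subseteq U$, the Cauchy completion $\mathrm{Ccl}(A)$ is the set of $a\in U$ such that for all finitely many $\varepsilon_1,\dots,\varepsilon_r$ there is $x\in A$ with $a\sim_{\varepsilon_j}x$ for all $j$. A c-model is an $L_H$-substructure $M$ of $U$ (with the restricted functions to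 $S$) such that every continuous formula $\varphi(a)$ with parameters $a$ in $M$ that is true in $M$ is true in $U$. A c-isomorphism between $A,B\subseteq U$ is a relation $R\subseteq A\times B$ with domain $A$ and range $B$ such that whenever $(a_i,b_i)\in R$ for $i<n$ and an atomic formula $t(x)\in C$ is true of $a$ in $U$, it is true of $b$ in $U$. $T$ is c-$\omega$-categorical if for any two countable c-models $M,N$ there is a c-isomorphism between $\mathrm{Ccl}(M)$ and $\mathrm{Ccl}(N)$. A set $p(x)$ of parameter-free continuous formulas in a finite tuple $x$ of variables of sort $H$ is consistent if it has a realization in $U$. It is approximately c-isolated if for every $\varepsilon$ there is a parameter-free continuous formula $\varphi(x)$ such that $\neg\varphi(x)$ is satisfied in $U$ by some realization of $p$, and every $a$ in $U$ with $\neg\varphi(a)$ has some realization $x'$ of $p$ in $U$ with $x'\sim_\varepsilon a$. \textbf{Theorem.} Assume that $F^c$ is separable. Then the following are equivalent: (1) $T$ is c-$\omega$-categorical; (2) every consistent set $p(x)$ of parameter-free continuous formulas, for $x$ any finite tuple of variables of sort $H$, is approximately c-isolated. -/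

import Mathlib

open Set Topology Cardinal

universe uf ur uF us uU uα uβ

namespace StdLogic

/-- An interpretation in the home sort `M` of the symbols of sort `H^n × S^m → S`; such a symbol is
an element of `F n m`. Each symbol is interpreted by an equicontinuous function.
Together with an `L.Structure M` this is a standard structure `⟨M, S⟩`. -/
class StandardStructure (F : ℕ → ℕ → Type uF) (S : Type us) [TopologicalSpace S]
    (M : Type uU) where
  sfun : ∀ {n m : ℕ}, F n m → (Fin n → M) → (Fin m → S) → S
  equicontinuous : ∀ {n m : ℕ} (g : F n m) (D : Set (S × S)),
    IsClosed D → D ∈ 𝓝ˢ (diagonal S) →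
      ∃ E : Set ((Fin m → S) × (Fin m → S)), IsOpen E ∧ diagonal (Fin m → S) ⊆ E ∧
        ∀ (a : Fin n → M) (s t : Fin m → S), (s, t) ∈ E → (sfun g a s, sfun g a t) ∈ D

/-- A substructure of the home sort, with the restricted functions to `S`. -/
instance {L : FirstOrder.Language.{uf, ur}} (F : ℕ → ℕ → Type uF) (S : Type us) [TopologicalSpace S]
    {U : Type uU} [L.Structure U] [StandardStructure F S U] (M : L.Substructure U) :
    StandardStructure F S M where
  sfun g a s := StandardStructure.sfun g (fun i => (a i : U)) s
  equicontinuous g D hD hD' := by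
    obtain ⟨E, hE, hΔ, h⟩ := StandardStructure.equicontinuous (M := U) g D hD hD'
    exact ⟨E, hE, hΔ, fun a s t hst => h _ s t hst⟩

/-- Terms of sort `S`, with variables `α` of sort `H` and `β` of sort `S`. There is a function
symbol for each continuous `S^m → S` (for `m = 0`, a constant for each element of `S`). -/
inductive STerm (L : FirstOrder.Language.{uf, ur}) (F : ℕ → ℕ → Type uF) (S : Type us) [TopologicalSpace S]
    (α : Type uα) (β : Type uβ) : Type (max uf uF us uα uβ)
  | var (b : β) : STerm L F S α β
  | cont {m : ℕ} (f : C(Fin m → S, S)) (t : Fin m → STerm L F S α β) : STerm L F S α β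
  | app {n m : ℕ} (g : F n m) (r : Fin n → L.Term α) (t : Fin m → STerm L F S α β) :
      STerm L F S α β

/-- The value of a term of sort `S`. -/
def STerm.realize {L : FirstOrder.Language.{uf, ur}} {F : ℕ → ℕ → Type uF} {S : Type us} [TopologicalSpace S]
    {α : Type uα} {β : Type uβ} {M : Type uU} [L.Structure M] [StandardStructure F S M]
    (v : α → M) (w : β → S) : STerm L F S α β → S
  | .var b => w b
  | .cont f t => f (fun i => (t i).realize v w)
  | .app g r t =>
      StandardStructure.sfun g (fun i => (r i).realize v) (fun i => (t i).realize v w)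

/-- Positive formulas. The free variables are `α` and `Fin n` of sort `H`, and `Fin m` of sort `S`;
the elements of `α` serve as names of parameters. The atomic formulas are
`home φ`, for an arbitrary first-order formula `φ` of the home language (Morleyization), and
`mem C t`, which says that the tuple of terms `t` belongs to the compact set `C ⊆ S^k`. -/
inductive PosFormula (L : FirstOrder.Language.{uf, ur}) (F : ℕ → ℕ → Type uF) (S : Type us)
    [TopologicalSpace S] (α : Type uα) : ℕ → ℕ → Type (max uf ur uF us uα)
  | home {n m : ℕ} (φ : L.BoundedFormula α n) : PosFormula L F S α n m
  | mem {n m k : ℕ} (C : TopologicalSpace.Compacts (Fin k → S))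
      (t : Fin k → STerm L F S (α ⊕ Fin n) (Fin m)) : PosFormula L F S α n m
  | and {n m : ℕ} (φ ψ : PosFormula L F S α n m) : PosFormula L F S α n m
  | or {n m : ℕ} (φ ψ : PosFormula L F S α n m) : PosFormula L F S α n m
  | allH {n m : ℕ} (φ : PosFormula L F S α (n + 1) m) : PosFormula L F S α n m
  | exH {n m : ℕ} (φ : PosFormula L F S α (n + 1) m) : PosFormula L F S α n m
  | allS {n m : ℕ} (φ : PosFormula L F S α n (m + 1)) : PosFormula L F S α n m
  | exS {n m : ℕ} (φ : PosFormula L F S α n (m + 1)) : PosFormula L F S α n m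

namespace PosFormula

/-- Truth of a positive formula in the standard structure `⟨M, S⟩`. -/
def Realize {L : FirstOrder.Language.{uf, ur}} {F : ℕ → ℕ → Type uF} {S : Type us} [TopologicalSpace S]
    {α : Type uα} (M : Type uU) [L.Structure M] [StandardStructure F S M] (v : α → M) :
    ∀ {n m : ℕ}, PosFormula L F S α n m → (Fin n → M) → (Fin m → S) → Prop
  | _, _, .home φ, x, _ => φ.Realize v x
  | _, _, .mem C t, x, η => (fun i => (t i).realize (Sum.elim v x) η) ∈ C
  | _, _, .and φ ψ, x, η => φ.Realize M v x η ∧ ψ.Realize M v x η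
  | _, _, .or φ ψ, x, η => φ.Realize M v x η ∨ ψ.Realize M v x η
  | _, _, .allH φ, x, η => ∀ b : M, φ.Realize M v (Fin.snoc (α := fun _ => M) x b) η
  | _, _, .exH φ, x, η => ∃ b : M, φ.Realize M v (Fin.snoc (α := fun _ => M) x b) η
  | _, _, .allS φ, x, η => ∀ s : S, φ.Realize M v x (Fin.snoc (α := fun _ => S) η s)
  | _, _, .exS φ, x, η => ∃ s : S, φ.Realize M v x (Fin.snoc (α := fun _ => S) η s)

/-- A continuous formula: no atomic formula of the home language occurs. -/
def IsContinuous {L : FirstOrder.Language.{uf, ur}} {F : ℕ → ℕ → Type uF} {S : Type us} [TopologicalSpace S]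
    {α : Type uα} : ∀ {n m : ℕ}, PosFormula L F S α n m → Prop
  | _, _, .home _ => False
  | _, _, .mem _ _ => True
  | _, _, .and φ ψ => φ.IsContinuous ∧ ψ.IsContinuous
  | _, _, .or φ ψ => φ.IsContinuous ∧ ψ.IsContinuous
  | _, _, .allH φ => φ.IsContinuous
  | _, _, .exH φ => φ.IsContinuous
  | _, _, .allS φ => φ.IsContinuous
  | _, _, .exS φ => φ.IsContinuous

/-- `Weakening φ φ'` says `φ' > φ`: the formula `φ'` is obtained from `φ` by replacing each atomic
formula `t ∈ C` by `t ∈ C'` for some compact neighborhood `C'` of `C`. -/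
inductive Weakening {L : FirstOrder.Language.{uf, ur}} {F : ℕ → ℕ → Type uF} {S : Type us}
    [TopologicalSpace S] {α : Type uα} :
    ∀ {n m : ℕ}, PosFormula L F S α n m → PosFormula L F S α n m → Prop
  | home {n m : ℕ} (φ : L.BoundedFormula α n) :
      Weakening (PosFormula.home (m := m) φ) (PosFormula.home (m := m) φ)
  | mem {n m k : ℕ} (C C' : TopologicalSpace.Compacts (Fin k → S))
      (t : Fin k → STerm L F S (α ⊕ Fin n) (Fin m))
      (h : (C' : Set (Fin k → S)) ∈ 𝓝ˢ (C : Set (Fin k → S))) :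
      Weakening (PosFormula.mem C t) (PosFormula.mem C' t)
  | and {n m : ℕ} {φ φ' ψ ψ' : PosFormula L F S α n m} :
      Weakening φ φ' → Weakening ψ ψ' → Weakening (φ.and ψ) (φ'.and ψ')
  | or {n m : ℕ} {φ φ' ψ ψ' : PosFormula L F S α n m} :
      Weakening φ φ' → Weakening ψ ψ' → Weakening (φ.or ψ) (φ'.or ψ')
  | allH {n m : ℕ} {φ φ' : PosFormula L F S α (n + 1) m} :
      Weakening φ φ' → Weakening φ.allH φ'.allH
  | exH {n m : ℕ} {φ φ' : PosFormula L F S α (n + 1) m} :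
      Weakening φ φ' → Weakening φ.exH φ'.exH
  | allS {n m : ℕ} {φ φ' : PosFormula L F S α n (m + 1)} :
      Weakening φ φ' → Weakening φ.allS φ'.allS
  | exS {n m : ℕ} {φ φ' : PosFormula L F S α n (m + 1)} :
      Weakening φ φ' → Weakening φ.exS φ'.exS

/-- Truth in `M` of a parameter-free formula `φ(x)` whose free variables have sort `H`. -/
def Holds {L : FirstOrder.Language.{uf, ur}} {F : ℕ → ℕ → Type uF} {S : Type us} [TopologicalSpace S]
    (M : Type uU) [L.Structure M] [StandardStructure F S M] {n : ℕ}
    (φ : PosFormula L F S Empty n 0) (x : Fin n → M) : Prop :=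
  φ.Realize M Empty.elim x Fin.elim0

end PosFormula

section

variable (L : FirstOrder.Language.{uf, ur}) (F : ℕ → ℕ → Type uF) (S : Type us) [TopologicalSpace S]
variable (U : Type uU) [L.Structure U] [StandardStructure F S U]

/-- `U` is positively `κ`-saturated: it realizes every set of positive formulas, with fewer than
`κ` parameters from `U` and finitely many free variables of both sorts, that is finitely
satisfied in `U`. -/
def PosSaturated (κ : Cardinal.{uU}) : Prop :=
  ∀ A : Set U, #A < κ → ∀ (n m : ℕ) (p : Set (PosFormula L F S A n m)),
    (∀ p₀ ⊆ p, p₀.Finite →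
      ∃ (x : Fin n → U) (η : Fin m → S), ∀ φ ∈ p₀, φ.Realize U (fun a : A => (a : U)) x η) →
    ∃ (x : Fin n → U) (η : Fin m → S), ∀ φ ∈ p, φ.Realize U (fun a : A => (a : U)) x η

/-- The positive theory of `U`. -/
def posTheory : Set (PosFormula L F S Empty 0 0) :=
  {φ | φ.Holds U Fin.elim0}

/-- A set `H` of parameter-free formulas (in the variables `x₀, …, xₙ₋₁` of sort `H`) is c-dense
modulo the positive theory `T` of `U`: for all continuous `φ` and all `φ' > φ` some `ψ ∈ H` satisfies
`φ → ψ → φ'` in every standard structure that models `T`. -/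
def IsCDense (H : Set (Σ n : ℕ, PosFormula L F S Empty n 0)) : Prop :=
  ∀ (n : ℕ) (φ φ' : PosFormula L F S Empty n 0), φ.IsContinuous → φ.Weakening φ' →
    ∃ ψ : PosFormula L F S Empty n 0, ⟨n, ψ⟩ ∈ H ∧
      ∀ (M : Type uU) [L.Structure M] [StandardStructure F S M],
        (∀ θ ∈ posTheory L F S U, θ.Holds M Fin.elim0) →
        ∀ x : Fin n → M, (φ.Holds M x → ψ.Holds M x) ∧ (ψ.Holds M x → φ'.Holds M x)

/-- The set of continuous formulas is separable (modulo the positive theory of `U`): there is a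
countable c-dense set of continuous formulas. -/
def ContinuousSeparable : Prop :=
  ∃ H : Set (Σ n : ℕ, PosFormula L F S Empty n 0),
    H.Countable ∧ (∀ ψ ∈ H, ψ.2.IsContinuous) ∧ IsCDense L F S U H

/-- The index set of the relations `x ∼_{τ,D} y` between `n`-tuples of sort `H`: finite tuples
`τ(x, z)` of terms of sort `S` with variables of sort `H` only, and compact neighborhoods `D` of the
diagonal of `S × S`. -/
structure Entourage (n : ℕ) where
  k : ℕ
  l : ℕ
  τ : Fin k → STerm L F S (Fin n ⊕ Fin l) Empty
  D : Set (S × S)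
  isCompact_D : IsCompact D
  D_mem : D ∈ 𝓝ˢ (diagonal S)

variable {L F S U}

/-- `x ∼_{τ,D} y`, that is `⟨τᵢ(x, z), τᵢ(y, z)⟩ ∈ D` for every `i` and every tuple `z` in `U`. -/
def Entourage.Rel {n : ℕ} (ε : Entourage L F S n) (x y : Fin n → U) : Prop :=
  ∀ (z : Fin ε.l → U) (i : Fin ε.k),
    ((ε.τ i).realize (Sum.elim x z) Empty.elim, (ε.τ i).realize (Sum.elim y z) Empty.elim) ∈ ε.D

variable (L F S)

/-- The Cauchy completion `Ccl(A)`: all `a ∈ U` such that `{a ∼_ε x : ε}` is finitely satisfied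
in `A`. -/
def cauchyCompletion (A : Set U) : Set U :=
  {a | ∀ E : Set (Entourage L F S 1), E.Finite →
    ∃ x ∈ A, ∀ ε ∈ E, ε.Rel (fun _ => a) (fun _ => x)}

variable {L}

/-- A c-model: a substructure `M` of `U` such that every continuous formula with parameters in `M`
that holds in `M` holds in `U`. -/
def IsCModel (M : L.Substructure U) : Prop :=
  ∀ (n : ℕ) (φ : PosFormula L F S Empty n 0), φ.IsContinuous →
    ∀ a : Fin n → M, φ.Holds M a → φ.Holds U (fun i => (a i : U))

variable (L)

/-- `R` preserves the truth (in `U`) of atomic continuous formulas `t(x) ∈ C`. -/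
def PreservesAtomic (R : U → U → Prop) : Prop :=
  ∀ (n k : ℕ) (C : TopologicalSpace.Compacts (Fin k → S))
    (t : Fin k → STerm L F S (Empty ⊕ Fin n) (Fin 0)) (a b : Fin n → U),
    (∀ i, R (a i) (b i)) →
      (PosFormula.mem C t).Holds U a → (PosFormula.mem C t).Holds U b

/-- `A` and `B` are c-isomorphic: some relation with domain `A` and range `B` preserves the truth
of atomic continuous formulas. -/
def CIsomorphic (A B : Set U) : Prop :=
  ∃ R : U → U → Prop, PreservesAtomic L F S R ∧
    {a | ∃ b, R a b} = A ∧ {b | ∃ a, R a b} = B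

variable (U)

/-- c-ω-categoricity of the theory of `U`: any two countable c-models have c-isomorphic Cauchy
completions. -/
def COmegaCategorical : Prop :=
  ∀ M N : L.Substructure U, Countable M → Countable N → IsCModel F S M → IsCModel F S N →
    CIsomorphic L F S (cauchyCompletion L F S (M : Set U)) (cauchyCompletion L F S (N : Set U))

variable {L F S}

/-- A parameter-free type is consistent if it has a realization in `U`. -/
def Consistent {n : ℕ} (p : Set (PosFormula L F S Empty n 0)) : Prop :=
  ∃ a : Fin n → U, ∀ ψ ∈ p, ψ.Holds U a

/-- `p(x)` is approximately c-isolated (by the empty set of parameters): for every `ε` there is a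
continuous `φ(x)` such that `¬ φ(x)` is consistent with `p(x)` and implies `∃ x' ∼_ε x, p(x')`. -/
def ApproxCIsolated {n : ℕ} (p : Set (PosFormula L F S Empty n 0)) : Prop :=
  ∀ ε : Entourage L F S n, ∃ φ : PosFormula L F S Empty n 0, φ.IsContinuous ∧
    (∃ a : Fin n → U, ¬ φ.Holds U a ∧ ∀ ψ ∈ p, ψ.Holds U a) ∧
    ∀ a : Fin n → U, ¬ φ.Holds U a → ∃ a' : Fin n → U, ε.Rel a' a ∧ ∀ ψ ∈ p, ψ.Holds U a'

end

end StdLogic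

/-! Formulas are handled through the sets of tuples they define (`CDef`). These are closed under
finite unions and intersections and under both quantifiers over the home sort, but not under
complement. In place of negation there is interpolation. By saturation a continuous formula is the
conjunction of its weakenings, and a strong negation fits between the formula and each weakening, so
definable sets behave like closed sets of a regular space (`CDef.exists_regular`). The relations
`∼_ε` generate a uniformity on `U` for which definable sets are closed and the Cauchy completion is
the closure. Separability makes it countably generated and saturation makes it complete, so `U`
becomes a complete pseudometric space. The c-models are the substructures that pass a Tarski–Vaught
test for complements of definable sets.

From isolation to categoricity (`cIsomorphic_closure`): a back-and-forth with errors. At stage `s`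
there are tuples of length `s` from the two models, the second within `2⁻ˢ` of a realization of the
type of the first. To add an element, isolate the type of the extended tuple: it has an open
definable neighbourhood consisting of points close to realizations, and the Tarski–Vaught test finds
such a point in the other model (`TypeClose.exists_extension`). The earlier coordinates move, but
summably. The limit sequences have equal types, and the closure of the correspondence between them
is the c-isomorphism.

From categoricity to isolation (`COmegaCategorical.approxCIsolated`): omitting types. The sequences
in `U`, topologized by definable sets, form a compact R1 space, hence a Baire space. If `p` is not
isolated at `ε`, the terms in a generic sequence form a countable c-model whose tuples stay
uniformly away from realizations of `p`. By Löwenheim–Skolem another countable c-model contains a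
realization. A c-isomorphism of the completions preserves continuous formulas, so it would put a
realization of `p` into the closure of the first model, a contradiction. -/

namespace StdLogic

/-! ### Syntax: substitution, supports and weakenings. -/

section PositiveFormulas

theorem exists_term_support {L : FirstOrder.Language.{uf, ur}} {α : Type*} {M : Type*}
    [L.Structure M] (r : L.Term α) :
    ∃ s : Finset α, ∀ v v' : α → M, (∀ i ∈ s, v i = v' i) → r.realize v = r.realize v' := by
  classical
  induction r with
  | var a => exact ⟨{a}, fun v v' h => h a (by simp)⟩
  | func f ts ih =>
    choose s hs using ih
    refine ⟨Finset.univ.biUnion s, fun v v' h => ?_⟩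
    simp only [FirstOrder.Language.Term.realize]
    congr 1
    funext i
    exact hs i v v' fun j hj => h j (Finset.mem_biUnion.2 ⟨i, Finset.mem_univ _, hj⟩)

variable {L : FirstOrder.Language.{uf, ur}} {F : ℕ → ℕ → Type uF} {S : Type us} [TopologicalSpace S]

namespace STerm

/-- Substitute terms for the variables of sort `H`, and variables or constants for the variables of
sort `S`. -/
def subst {α α' β β' : Type*} (σ : α → L.Term α') (ρ : β → β' ⊕ S) :
    STerm L F S α β → STerm L F S α' β'
  | .var b => Sum.elim STerm.var
      (fun s => STerm.cont (m := 0) (ContinuousMap.const _ s) Fin.elim0) (ρ b)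
  | .cont f t => .cont f (fun i => (t i).subst σ ρ)
  | .app g r t => .app g (fun i => (r i).subst σ) (fun i => (t i).subst σ ρ)

theorem realize_subst {α α' β β' : Type*} {M : Type*} [L.Structure M] [StandardStructure F S M]
    (σ : α → L.Term α') (ρ : β → β' ⊕ S) (v : α' → M) (w : β' → S) (t : STerm L F S α β) :
    (t.subst σ ρ).realize v w =
      t.realize (fun a => (σ a).realize v) (fun b => Sum.elim w id (ρ b)) := by
  induction t with
  | var b => cases h : ρ b <;> simp [subst, realize, h]
  | cont f t ih => simp [subst, realize, ih]
  | app g r t ih => simp [subst, realize, ih, FirstOrder.Language.Term.realize_subst]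

theorem exists_support {α β : Type*} {M : Type*} [L.Structure M] [StandardStructure F S M]
    (t : STerm L F S α β) : ∃ s : Finset α, ∀ (v v' : α → M) (w : β → S),
      (∀ i ∈ s, v i = v' i) → t.realize v w = t.realize v' w := by
  classical
  induction t with
  | var b => exact ⟨∅, fun v v' w _ => rfl⟩
  | cont f t ih =>
    choose s hs using ih
    refine ⟨Finset.univ.biUnion s, fun v v' w h => ?_⟩
    simp only [realize]
    congr 1
    funext i
    exact hs i v v' w fun j hj => h j (Finset.mem_biUnion.2 ⟨i, Finset.mem_univ _, hj⟩)
  | app g r t ih =>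
    choose s hs using ih
    choose s' hs' using fun i => exists_term_support (M := M) (r i)
    refine ⟨Finset.univ.biUnion s ∪ Finset.univ.biUnion s', fun v v' w h => ?_⟩
    simp only [realize]
    congr 1
    · funext i
      exact hs' i v v' fun j hj => h j
        (Finset.mem_union_right _ (Finset.mem_biUnion.2 ⟨i, Finset.mem_univ _, hj⟩))
    · funext i
      exact hs i v v' w fun j hj => h j
        (Finset.mem_union_left _ (Finset.mem_biUnion.2 ⟨i, Finset.mem_univ _, hj⟩))

end STerm

namespace PosFormula

variable {α β : Type*}

/-- Extend a substitution under a quantifier of sort `H`. -/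
def liftH {n n' : ℕ} (σ : α ⊕ Fin n → L.Term (β ⊕ Fin n')) :
    α ⊕ Fin (n + 1) → L.Term (β ⊕ Fin (n' + 1)) :=
  Sum.elim (fun a => (σ (.inl a)).relabel (Sum.map id Fin.castSucc))
    (Fin.snoc (α := fun _ => L.Term (β ⊕ Fin (n' + 1)))
      (fun i => (σ (.inr i)).relabel (Sum.map id Fin.castSucc))
      (FirstOrder.Language.Term.var (.inr (Fin.last n'))))

/-- Extend a substitution under a quantifier of sort `S`. -/
def liftS {m m' : ℕ} (ρ : Fin m → Fin m' ⊕ S) : Fin (m + 1) → Fin (m' + 1) ⊕ S :=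
  Fin.snoc (α := fun _ => Fin (m' + 1) ⊕ S) (fun i => Sum.map Fin.castSucc id (ρ i))
    (.inl (Fin.last m'))

/-- Substitution in continuous formulas. -/
def subst : ∀ {n m n' m' : ℕ}, (α ⊕ Fin n → L.Term (β ⊕ Fin n')) → (Fin m → Fin m' ⊕ S) →
    PosFormula L F S α n m → PosFormula L F S β n' m'
  -- Junk value (falsity); the lemmas about substitution assume the formula continuous.
  | _, _, _, _, _, _, .home _ => .mem (k := 0) ⊥ Fin.elim0
  | _, _, _, _, σ, ρ, .mem C t => .mem C (fun i => (t i).subst σ ρ)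
  | _, _, _, _, σ, ρ, .and φ ψ => .and (φ.subst σ ρ) (ψ.subst σ ρ)
  | _, _, _, _, σ, ρ, .or φ ψ => .or (φ.subst σ ρ) (ψ.subst σ ρ)
  | _, _, _, _, σ, ρ, .allH φ => .allH (φ.subst (liftH σ) ρ)
  | _, _, _, _, σ, ρ, .exH φ => .exH (φ.subst (liftH σ) ρ)
  | _, _, _, _, σ, ρ, .allS φ => .allS (φ.subst σ (liftS ρ))
  | _, _, _, _, σ, ρ, .exS φ => .exS (φ.subst σ (liftS ρ))

theorem IsContinuous.subst {n m n' m' : ℕ} (σ : α ⊕ Fin n → L.Term (β ⊕ Fin n'))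
    (ρ : Fin m → Fin m' ⊕ S) {φ : PosFormula L F S α n m} (h : φ.IsContinuous) :
    (φ.subst σ ρ).IsContinuous := by
  induction φ generalizing n' m' with
  | home => exact h.elim
  | mem => trivial
  | and φ ψ ih ih' => exact ⟨ih _ _ h.1, ih' _ _ h.2⟩
  | or φ ψ ih ih' => exact ⟨ih _ _ h.1, ih' _ _ h.2⟩
  | allH φ ih => exact ih _ _ h
  | exH φ ih => exact ih _ _ h
  | allS φ ih => exact ih _ _ h
  | exS φ ih => exact ih _ _ h

variable {M : Type*} [L.Structure M] [StandardStructure F S M]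

theorem realize_liftH {n n' : ℕ} (σ : α ⊕ Fin n → L.Term (β ⊕ Fin n')) (v : β → M)
    (x : Fin n' → M) (b : M) :
    (fun i => (liftH σ (.inr i)).realize (Sum.elim v (Fin.snoc (α := fun _ => M) x b))) =
      Fin.snoc (α := fun _ => M) (fun i => (σ (.inr i)).realize (Sum.elim v x)) b := by
  funext i
  refine Fin.lastCases ?_ (fun i => ?_) i
  · simp [liftH]
  · simp only [liftH, Sum.elim_inr, Fin.snoc_castSucc, FirstOrder.Language.Term.realize_relabel]
    congr 1
    funext j
    cases j <;> simp

theorem realize_liftH_inl {n n' : ℕ} (σ : α ⊕ Fin n → L.Term (β ⊕ Fin n')) (v : β → M)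
    (x : Fin n' → M) (b : M) :
    (fun a => (liftH σ (.inl a)).realize (Sum.elim v (Fin.snoc (α := fun _ => M) x b))) =
      (fun a => (σ (.inl a)).realize (Sum.elim v x)) := by
  funext a
  simp only [liftH, Sum.elim_inl, FirstOrder.Language.Term.realize_relabel]
  congr 1
  funext j
  cases j <;> simp

theorem elim_liftS {S : Type us} {m m' : ℕ} (ρ : Fin m → Fin m' ⊕ S) (η : Fin m' → S) (s : S) :
    (fun j => Sum.elim (Fin.snoc (α := fun _ => S) η s) id (liftS ρ j)) =
      Fin.snoc (α := fun _ => S) (fun j => Sum.elim η id (ρ j)) s := by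
  funext j
  refine Fin.lastCases ?_ (fun j => ?_) j
  · simp [liftS]
  · simp only [liftS, Fin.snoc_castSucc]
    cases ρ j <;> simp

theorem realize_subst {n m n' m' : ℕ} (σ : α ⊕ Fin n → L.Term (β ⊕ Fin n'))
    (ρ : Fin m → Fin m' ⊕ S) {φ : PosFormula L F S α n m} (h : φ.IsContinuous)
    (v : β → M) (x : Fin n' → M) (η : Fin m' → S) :
    (φ.subst σ ρ).Realize M v x η ↔
      φ.Realize M (fun a => (σ (.inl a)).realize (Sum.elim v x))
        (fun i => (σ (.inr i)).realize (Sum.elim v x)) (fun j => Sum.elim η id (ρ j)) := by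
  induction φ generalizing n' m' with
  | home => exact h.elim
  | mem C t =>
    simp only [subst, Realize, STerm.realize_subst]
    have : (fun a => (σ a).realize (Sum.elim v x)) = Sum.elim
        (fun a => (σ (.inl a)).realize (Sum.elim v x))
        (fun i => (σ (.inr i)).realize (Sum.elim v x)) := by
      funext a; cases a <;> rfl
    rw [this]
  | and φ ψ ih ih' => exact and_congr (ih _ _ h.1 _ _) (ih' _ _ h.2 _ _)
  | or φ ψ ih ih' => exact or_congr (ih _ _ h.1 _ _) (ih' _ _ h.2 _ _)
  | allH φ ih =>
    refine forall_congr' fun b => ?_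
    rw [ih _ _ h, realize_liftH, realize_liftH_inl]
  | exH φ ih =>
    refine exists_congr fun b => ?_
    rw [ih _ _ h, realize_liftH, realize_liftH_inl]
  | allS φ ih =>
    refine forall_congr' fun b => ?_
    rw [ih _ _ h, elim_liftS]
  | exS φ ih =>
    refine exists_congr fun b => ?_
    rw [ih _ _ h, elim_liftS]

theorem exists_support {n m : ℕ} {φ : PosFormula L F S α n m} (h : φ.IsContinuous) :
    ∃ s : Finset α, ∀ (v v' : α → M) (x : Fin n → M) (η : Fin m → S),
      (∀ i ∈ s, v i = v' i) → (φ.Realize M v x η ↔ φ.Realize M v' x η) := by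
  classical
  induction φ with
  | home => exact h.elim
  | @mem n m k C t =>
    choose s hs using fun i => (t i).exists_support (M := M)
    refine ⟨(Finset.univ.biUnion s).preimage Sum.inl Sum.inl_injective.injOn,
      fun v v' x η hv => ?_⟩
    simp only [Realize]
    have : ∀ i, (t i).realize (Sum.elim v x) η = (t i).realize (Sum.elim v' x) η := by
      intro i
      apply hs i
      rintro (j | j) hj
      · exact hv j (Finset.mem_preimage.2 (Finset.mem_biUnion.2 ⟨i, Finset.mem_univ _, hj⟩))
      · rfl
    simp only [this]
  | and φ ψ ih ih' =>
    obtain ⟨s, hs⟩ := ih h.1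
    obtain ⟨s', hs'⟩ := ih' h.2
    exact ⟨s ∪ s', fun v v' x η hv => and_congr
      (hs _ _ _ _ fun i hi => hv i (Finset.mem_union_left _ hi))
      (hs' _ _ _ _ fun i hi => hv i (Finset.mem_union_right _ hi))⟩
  | or φ ψ ih ih' =>
    obtain ⟨s, hs⟩ := ih h.1
    obtain ⟨s', hs'⟩ := ih' h.2
    exact ⟨s ∪ s', fun v v' x η hv => or_congr
      (hs _ _ _ _ fun i hi => hv i (Finset.mem_union_left _ hi))
      (hs' _ _ _ _ fun i hi => hv i (Finset.mem_union_right _ hi))⟩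
  | allH φ ih =>
    obtain ⟨s, hs⟩ := ih h
    exact ⟨s, fun v v' x η hv => forall_congr' fun b => hs _ _ _ _ hv⟩
  | exH φ ih =>
    obtain ⟨s, hs⟩ := ih h
    exact ⟨s, fun v v' x η hv => exists_congr fun b => hs _ _ _ _ hv⟩
  | allS φ ih =>
    obtain ⟨s, hs⟩ := ih h
    exact ⟨s, fun v v' x η hv => forall_congr' fun b => hs _ _ _ _ hv⟩
  | exS φ ih =>
    obtain ⟨s, hs⟩ := ih h
    exact ⟨s, fun v v' x η hv => exists_congr fun b => hs _ _ _ _ hv⟩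

theorem Weakening.isContinuous {n m : ℕ} {φ φ' : PosFormula L F S α n m} (h : φ.Weakening φ')
    (hφ : φ.IsContinuous) : φ'.IsContinuous := by
  induction h with
  | home => exact hφ
  | mem => trivial
  | and _ _ ih ih' => exact ⟨ih hφ.1, ih' hφ.2⟩
  | or _ _ ih ih' => exact ⟨ih hφ.1, ih' hφ.2⟩
  | allH _ ih => exact ih hφ
  | exH _ ih => exact ih hφ
  | allS _ ih => exact ih hφ
  | exS _ ih => exact ih hφ

theorem Weakening.realize {n m : ℕ} {φ φ' : PosFormula L F S α n m} (h : φ.Weakening φ')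
    {v : α → M} {x : Fin n → M} {η : Fin m → S} (hφ : φ.Realize M v x η) :
    φ'.Realize M v x η := by
  induction h with
  | home => exact hφ
  | mem C C' t h => exact subset_of_mem_nhdsSet h hφ
  | and _ _ ih ih' => exact ⟨ih hφ.1, ih' hφ.2⟩
  | or _ _ ih ih' => exact hφ.imp ih ih'
  | allH _ ih => exact fun b => ih (hφ b)
  | exH _ ih => exact hφ.imp fun b => ih
  | allS _ ih => exact fun b => ih (hφ b)
  | exS _ ih => exact hφ.imp fun b => ih

section Compact

/-- Intersect the two neighbourhoods atom by atom. Directedness is what lets saturation treat all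
weakenings at once. -/
theorem Weakening.exists_inf [T2Space S] {n m : ℕ} {φ φ₁ φ₂ : PosFormula L F S α n m}
    (h₁ : φ.Weakening φ₁) (h₂ : φ.Weakening φ₂) :
    ∃ φ₀, φ.Weakening φ₀ ∧ ∀ (v : α → M) (x : Fin n → M) (η : Fin m → S),
      φ₀.Realize M v x η → φ₁.Realize M v x η ∧ φ₂.Realize M v x η := by
  induction h₁ with
  | home => cases h₂; exact ⟨_, .home _, fun v x η h => ⟨h, h⟩⟩
  | mem C C' t h =>
    cases h₂ with
    | mem _ C'' _ h' =>
      exact ⟨_, .mem C (C' ⊓ C'') t (Filter.inter_mem h h'), fun v x η h => h⟩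
  | and _ _ ih ih' =>
    cases h₂ with
    | and a b =>
      obtain ⟨p, hp, hp'⟩ := ih a
      obtain ⟨q, hq, hq'⟩ := ih' b
      exact ⟨_, .and hp hq, fun v x η h =>
        ⟨⟨(hp' _ _ _ h.1).1, (hq' _ _ _ h.2).1⟩, (hp' _ _ _ h.1).2, (hq' _ _ _ h.2).2⟩⟩
  | or _ _ ih ih' =>
    cases h₂ with
    | or a b =>
      obtain ⟨p, hp, hp'⟩ := ih a
      obtain ⟨q, hq, hq'⟩ := ih' b
      refine ⟨_, .or hp hq, fun v x η h => ?_⟩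
      rcases h with h | h
      · exact ⟨.inl (hp' _ _ _ h).1, .inl (hp' _ _ _ h).2⟩
      · exact ⟨.inr (hq' _ _ _ h).1, .inr (hq' _ _ _ h).2⟩
  | allH _ ih =>
    cases h₂ with
    | allH a =>
      obtain ⟨p, hp, hp'⟩ := ih a
      exact ⟨_, .allH hp, fun v x η h =>
        ⟨fun b => (hp' _ _ _ (h b)).1, fun b => (hp' _ _ _ (h b)).2⟩⟩
  | exH _ ih =>
    cases h₂ with
    | exH a =>
      obtain ⟨p, hp, hp'⟩ := ih a
      exact ⟨_, .exH hp, fun v x η ⟨b, h⟩ => ⟨⟨b, (hp' _ _ _ h).1⟩, ⟨b, (hp' _ _ _ h).2⟩⟩⟩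
  | allS _ ih =>
    cases h₂ with
    | allS a =>
      obtain ⟨p, hp, hp'⟩ := ih a
      exact ⟨_, .allS hp, fun v x η h =>
        ⟨fun b => (hp' _ _ _ (h b)).1, fun b => (hp' _ _ _ (h b)).2⟩⟩
  | exS _ ih =>
    cases h₂ with
    | exS a =>
      obtain ⟨p, hp, hp'⟩ := ih a
      exact ⟨_, .exS hp, fun v x η ⟨b, h⟩ => ⟨⟨b, (hp' _ _ _ h).1⟩, ⟨b, (hp' _ _ _ h).2⟩⟩⟩

variable [CompactSpace S]

theorem exists_weakening {n m : ℕ} (φ : PosFormula L F S α n m) : ∃ φ', φ.Weakening φ' := by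
  induction φ with
  | home φ => exact ⟨_, .home φ⟩
  | mem C t => exact ⟨_, .mem C ⟨univ, isCompact_univ⟩ t Filter.univ_mem⟩
  | and _ _ ih ih' => exact ⟨_, .and ih.choose_spec ih'.choose_spec⟩
  | or _ _ ih ih' => exact ⟨_, .or ih.choose_spec ih'.choose_spec⟩
  | allH _ ih => exact ⟨_, .allH ih.choose_spec⟩
  | exH _ ih => exact ⟨_, .exH ih.choose_spec⟩
  | allS _ ih => exact ⟨_, .allS ih.choose_spec⟩
  | exS _ ih => exact ⟨_, .exS ih.choose_spec⟩

/-- The strong negation: `φ` and `χ` exclude each other, and one of `χ`, `φ'` holds. -/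
theorem Weakening.exists_negation {n m : ℕ} {φ φ' : PosFormula L F S α n m}
    (h : φ.Weakening φ') (hφ : φ.IsContinuous) :
    ∃ χ : PosFormula L F S α n m, χ.IsContinuous ∧
      ∀ (M : Type uU) [L.Structure M] [StandardStructure F S M] (v : α → M) (x : Fin n → M)
        (η : Fin m → S), (φ.Realize M v x η → ¬ χ.Realize M v x η) ∧
          (¬ χ.Realize M v x η → φ'.Realize M v x η) := by
  induction h with
  | home => exact hφ.elim
  | @mem n m k C C' t h =>
    -- The complement of the interior is compact and still misses `C`; `C'` itself need not have
    -- compact complement.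
    have hK : IsCompact (interior (C' : Set (Fin k → S)))ᶜ :=
      isOpen_interior.isClosed_compl.isCompact
    refine ⟨.mem ⟨_, hK⟩ t, by simp only [IsContinuous], fun M _ _ v x η =>
      ⟨fun hC hn => hn (subset_interior_iff_mem_nhdsSet.2 h hC),
        fun hn => interior_subset (not_not.1 hn)⟩⟩
  | and _ _ ih ih' =>
    obtain ⟨p, hp, hp'⟩ := ih hφ.1
    obtain ⟨q, hq, hq'⟩ := ih' hφ.2
    refine ⟨p.or q, ⟨hp, hq⟩, fun M _ _ v x η => ?_⟩
    exact ⟨fun h hn => hn.elim ((hp' M v x η).1 h.1) ((hq' M v x η).1 h.2),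
      fun hn => (not_or.1 hn).imp (hp' M v x η).2 (hq' M v x η).2⟩
  | or _ _ ih ih' =>
    obtain ⟨p, hp, hp'⟩ := ih hφ.1
    obtain ⟨q, hq, hq'⟩ := ih' hφ.2
    refine ⟨p.and q, ⟨hp, hq⟩, fun M _ _ v x η => ?_⟩
    exact ⟨fun h hn => h.elim (fun h => (hp' M v x η).1 h hn.1) fun h => (hq' M v x η).1 h hn.2,
      fun hn => (not_and_or.1 hn).imp (hp' M v x η).2 (hq' M v x η).2⟩
  | allH _ ih =>
    obtain ⟨p, hp, hp'⟩ := ih hφ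
    refine ⟨p.exH, hp, fun M _ _ v x η => ⟨fun h ⟨b, hb⟩ => (hp' M v _ η).1 (h b) hb,
      fun h b => (hp' M v _ η).2 fun hb => h ⟨b, hb⟩⟩⟩
  | exH _ ih =>
    obtain ⟨p, hp, hp'⟩ := ih hφ
    refine ⟨p.allH, hp, fun M _ _ v x η => ⟨fun ⟨b, hb⟩ h => (hp' M v _ η).1 hb (h b),
      fun h => ?_⟩⟩
    obtain ⟨b, hb⟩ := not_forall.1 h
    exact ⟨b, (hp' M v _ η).2 hb⟩
  | allS _ ih =>
    obtain ⟨p, hp, hp'⟩ := ih hφ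
    refine ⟨p.exS, hp, fun M _ _ v x η => ⟨fun h ⟨b, hb⟩ => (hp' M v x _).1 (h b) hb,
      fun h b => (hp' M v x _).2 fun hb => h ⟨b, hb⟩⟩⟩
  | exS _ ih =>
    obtain ⟨p, hp, hp'⟩ := ih hφ
    refine ⟨p.allS, hp, fun M _ _ v x η => ⟨fun ⟨b, hb⟩ h => (hp' M v x _).1 hb (h b),
      fun h => ?_⟩⟩
    obtain ⟨b, hb⟩ := not_forall.1 h
    exact ⟨b, (hp' M v x _).2 hb⟩

variable [T2Space S]

theorem exists_weakening_of_finite {n m : ℕ} (φ : PosFormula L F S α n m)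
    {p : Set (PosFormula L F S α n m)} (hp : p.Finite) (h : ∀ φ' ∈ p, φ.Weakening φ') :
    ∃ φ₀, φ.Weakening φ₀ ∧ ∀ φ' ∈ p, ∀ (v : α → M) (x : Fin n → M) (η : Fin m → S),
      φ₀.Realize M v x η → φ'.Realize M v x η := by
  induction p, hp using Set.Finite.induction_on with
  | empty => exact ⟨_, φ.exists_weakening.choose_spec, by simp⟩
  | insert _ _ ih =>
    obtain ⟨φ₀, h₀, h₀'⟩ := ih fun φ' hφ' => h φ' (mem_insert_of_mem _ hφ')
    obtain ⟨φ₁, h₁, h₁'⟩ := h₀.exists_inf (M := M) (h _ (mem_insert _ _))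
    refine ⟨φ₁, h₁, ?_⟩
    rintro φ' (rfl | hφ') v x η hx
    · exact (h₁' _ _ _ hx).2
    · exact h₀' φ' hφ' _ _ _ (h₁' _ _ _ hx).1

/-- Local compactness, applied to each atom: a compact neighbourhood of `C` fits inside the interior
of `C'`. -/
theorem Weakening.exists_between {n m : ℕ} {φ φ' : PosFormula L F S α n m}
    (h : φ.Weakening φ') : ∃ φ₁, φ.Weakening φ₁ ∧ φ₁.Weakening φ' := by
  induction h with
  | home φ => exact ⟨_, .home φ, .home φ⟩
  | mem C C' t h =>
    obtain ⟨K, hK, h1, h2⟩ := exists_compact_between C.isCompact isOpen_interior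
      (subset_interior_iff_mem_nhdsSet.2 h)
    exact ⟨_, .mem C ⟨K, hK⟩ t (subset_interior_iff_mem_nhdsSet.1 h1),
      .mem ⟨K, hK⟩ C' t (subset_interior_iff_mem_nhdsSet.1 h2)⟩
  | and _ _ ih ih' =>
    obtain ⟨p, hp, hp'⟩ := ih
    obtain ⟨q, hq, hq'⟩ := ih'
    exact ⟨_, .and hp hq, .and hp' hq'⟩
  | or _ _ ih ih' =>
    obtain ⟨p, hp, hp'⟩ := ih
    obtain ⟨q, hq, hq'⟩ := ih'
    exact ⟨_, .or hp hq, .or hp' hq'⟩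
  | allH _ ih =>
    obtain ⟨p, hp, hp'⟩ := ih
    exact ⟨_, .allH hp, .allH hp'⟩
  | exH _ ih =>
    obtain ⟨p, hp, hp'⟩ := ih
    exact ⟨_, .exH hp, .exH hp'⟩
  | allS _ ih =>
    obtain ⟨p, hp, hp'⟩ := ih
    exact ⟨_, .allS hp, .allS hp'⟩
  | exS _ ih =>
    obtain ⟨p, hp, hp'⟩ := ih
    exact ⟨_, .exS hp, .exS hp'⟩

end Compact

end PosFormula

end PositiveFormulas

/-! ### Saturation and definable sets. -/

section Definable

variable {L : FirstOrder.Language.{uf, ur}} {F : ℕ → ℕ → Type uF} {S : Type us}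
  [TopologicalSpace S] {U : Type uU} [L.Structure U] [StandardStructure F S U]

open FirstOrder.Language (Term)

theorem PosSaturated.exists_realize (hU : PosSaturated L F S U (Order.succ ℵ₀)) {A : Set U}
    (hA : A.Countable) {n m : ℕ} (p : Set (PosFormula L F S A n m))
    (hp : ∀ p₀ ⊆ p, p₀.Finite →
      ∃ (x : Fin n → U) (η : Fin m → S), ∀ φ ∈ p₀, φ.Realize U (fun a : A => (a : U)) x η) :
    ∃ (x : Fin n → U) (η : Fin m → S), ∀ φ ∈ p, φ.Realize U (fun a : A => (a : U)) x η :=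
  hU A (Order.lt_succ_iff.2 (mk_le_aleph0_iff.2 hA)) n m p hp

/-- Compactness for a family of instances of continuous formulas with countably many parameters. -/
theorem PosSaturated.exists_forall_realize (hU : PosSaturated L F S U (Order.succ ℵ₀))
    {α J : Type*} [Countable α] (v : α → U) {n m k l : ℕ} (x : Fin k → U) (η : Fin l → S)
    (φ : J → PosFormula L F S α (k + n) (l + m)) (hφ : ∀ j, (φ j).IsContinuous)
    (h : ∀ t : Set J, t.Finite → ∃ (y : Fin n → U) (ζ : Fin m → S), ∀ j ∈ t,
      (φ j).Realize U v (Fin.append x y) (Fin.append η ζ)) :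
    ∃ (y : Fin n → U) (ζ : Fin m → S), ∀ j,
      (φ j).Realize U v (Fin.append x y) (Fin.append η ζ) := by
  let A : Set U := range v ∪ range x
  have hA : A.Countable := (countable_range v).union (countable_range x)
  -- The tuples `x` and `η` are absorbed as parameters: `x` as names from `A`, `η` as constants of
  -- sort `S`.
  let σ : α ⊕ Fin (k + n) → L.Term (A ⊕ Fin n) := Sum.elim
    (fun a => .var (.inl ⟨v a, .inl ⟨a, rfl⟩⟩))
    (Fin.append (fun i => .var (.inl ⟨x i, .inr ⟨i, rfl⟩⟩)) (fun i => .var (.inr i)))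
  let ρ : Fin (l + m) → Fin m ⊕ S := Fin.append (fun i => .inr (η i)) .inl
  have hreal : ∀ j (y : Fin n → U) (ζ : Fin m → S),
      ((φ j).subst σ ρ).Realize U (fun a : A => (a : U)) y ζ ↔
        (φ j).Realize U v (Fin.append x y) (Fin.append η ζ) := by
    intro j y ζ
    rw [PosFormula.realize_subst _ _ (hφ j)]
    have h1 : (fun i => (σ (.inr i)).realize (Sum.elim (fun a : A => (a : U)) y)) =
        Fin.append x y := by
      funext i
      refine Fin.addCases (fun i => ?_) (fun i => ?_) i <;> simp [σ]
    have h2 : (fun i => Sum.elim ζ id (ρ i)) = Fin.append η ζ := by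
      funext i
      refine Fin.addCases (fun i => ?_) (fun i => ?_) i <;> simp [ρ]
    rw [h1, h2]
    rfl
  obtain ⟨y, ζ, hy⟩ := hU.exists_realize hA (range fun j => (φ j).subst σ ρ) (by
    intro p₀ hp₀ hfin
    choose g hg using fun ψ : p₀ => hp₀ ψ.2
    have := hfin.to_subtype
    obtain ⟨y, ζ, hy⟩ := h (range g) (finite_range g)
    refine ⟨y, ζ, fun ψ hψ => ?_⟩
    have e : (φ (g ⟨ψ, hψ⟩)).subst σ ρ = ψ := hg ⟨ψ, hψ⟩
    rw [← e]
    exact (hreal _ y ζ).2 (hy _ ⟨_, rfl⟩))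
  exact ⟨y, ζ, fun j => (hreal j y ζ).1 (hy _ ⟨j, rfl⟩)⟩

/-- In a saturated structure, a continuous formula is equivalent to the conjunction of its
weakenings. -/
theorem PosSaturated.exists_weakening_not_realize [CompactSpace S] [T2Space S]
    (hU : PosSaturated L F S U (Order.succ ℵ₀)) {α : Type*} [Countable α] {v : α → U} {n m : ℕ}
    {φ : PosFormula L F S α n m} (hφ : φ.IsContinuous) {x : Fin n → U} {η : Fin m → S}
    (h : ¬ φ.Realize U v x η) : ∃ φ', φ.Weakening φ' ∧ ¬ φ'.Realize U v x η := by
  induction φ with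
  | home => exact hφ.elim
  | @mem n m k C t =>
    obtain ⟨K, hK, h1, h2⟩ := exists_compact_between C.isCompact
      (isOpen_compl_singleton (x := fun i => (t i).realize (Sum.elim v x) η))
      (fun y hy hy' => h (by rw [mem_singleton_iff] at hy'; rw [hy'] at hy; exact hy))
    exact ⟨.mem ⟨K, hK⟩ t, .mem _ _ _ (subset_interior_iff_mem_nhdsSet.1 h1), fun h => h2 h rfl⟩
  | and φ ψ ih ih' =>
    rcases not_and_or.1 h with h | h
    · obtain ⟨φ', h1, h2⟩ := ih hφ.1 h
      obtain ⟨ψ', h3⟩ := ψ.exists_weakening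
      exact ⟨_, .and h1 h3, fun h => h2 h.1⟩
    · obtain ⟨φ', h1, h2⟩ := ih' hφ.2 h
      obtain ⟨ψ', h3⟩ := φ.exists_weakening
      exact ⟨_, .and h3 h1, fun h => h2 h.2⟩
  | or φ ψ ih ih' =>
    obtain ⟨φ', h1, h2⟩ := ih hφ.1 (not_or.1 h).1
    obtain ⟨ψ', h3, h4⟩ := ih' hφ.2 (not_or.1 h).2
    exact ⟨_, .or h1 h3, fun h => h.elim h2 h4⟩
  | allH φ ih =>
    obtain ⟨b, hb⟩ := not_forall.1 h
    obtain ⟨φ', h1, h2⟩ := ih hφ hb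
    exact ⟨_, .allH h1, fun h => h2 (h b)⟩
  | allS φ ih =>
    obtain ⟨b, hb⟩ := not_forall.1 h
    obtain ⟨φ', h1, h2⟩ := ih hφ hb
    exact ⟨_, .allS h1, fun h => h2 (h b)⟩
  -- Existential quantifiers are where saturation enters: finitely many weakenings have a common
  -- one, hence a common witness; a witness of all weakenings exists by saturation, and by induction
  -- it is a witness of `φ` itself.
  | exH φ ih =>
    by_contra! hc
    apply h
    obtain ⟨y, ζ, hy⟩ := hU.exists_forall_realize (n := 1) (m := 0) v x η
      (fun φ' : {φ' // φ.Weakening φ'} => φ'.1) (fun φ' => φ'.2.isContinuous hφ) (by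
        intro t ht
        obtain ⟨φ₀, h0, h0'⟩ := φ.exists_weakening_of_finite (M := U) (ht.image Subtype.val)
          (by rintro _ ⟨j, -, rfl⟩; exact j.2)
        obtain ⟨b, hb⟩ := hc _ (.exH h0)
        refine ⟨fun _ => b, Fin.elim0, fun j hj => h0' j ⟨j, hj, rfl⟩ _ _ _ ?_⟩
        rw [Fin.append_right_eq_snoc, Fin.append_elim0]
        exact hb)
    by_contra h'
    obtain ⟨φ', h1, h2⟩ := ih (x := Fin.append x y) (η := Fin.append η ζ) hφ (fun hh => h'
      ⟨y 0, by
        rw [Fin.append_right_eq_snoc, Subsingleton.elim ζ Fin.elim0, Fin.append_elim0] at hh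
        exact hh⟩)
    exact h2 (hy ⟨φ', h1⟩)
  | exS φ ih =>
    by_contra! hc
    apply h
    obtain ⟨y, ζ, hy⟩ := hU.exists_forall_realize (n := 0) (m := 1) v x η
      (fun φ' : {φ' // φ.Weakening φ'} => φ'.1) (fun φ' => φ'.2.isContinuous hφ) (by
        intro t ht
        obtain ⟨φ₀, h0, h0'⟩ := φ.exists_weakening_of_finite (M := U) (ht.image Subtype.val)
          (by rintro _ ⟨j, -, rfl⟩; exact j.2)
        obtain ⟨b, hb⟩ := hc _ (.exS h0)
        refine ⟨Fin.elim0, fun _ => b, fun j hj => h0' j ⟨j, hj, rfl⟩ _ _ _ ?_⟩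
        rw [Fin.append_right_eq_snoc, Fin.append_elim0]
        exact hb)
    by_contra h'
    obtain ⟨φ', h1, h2⟩ := ih (x := Fin.append x y) (η := Fin.append η ζ) hφ (fun hh => h'
      ⟨ζ 0, by
        rw [Fin.append_right_eq_snoc, Subsingleton.elim y Fin.elim0, Fin.append_elim0] at hh
        exact hh⟩)
    exact h2 (hy ⟨φ', h1⟩)

variable (L F S)

/-- A set of tuples of `U` that is defined by a continuous formula, with constants of sort `S` as
only parameters. -/
def CDef {ι : Type*} (P : Set (ι → U)) : Prop :=
  ∃ φ : PosFormula L F S ι 0 0, φ.IsContinuous ∧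
    ∀ v, v ∈ P ↔ φ.Realize U v Fin.elim0 Fin.elim0

variable {L F S}

theorem PosFormula.IsContinuous.cdef {α ι : Type*} {n m : ℕ} {φ : PosFormula L F S α n m}
    (hφ : φ.IsContinuous) (σ : α ⊕ Fin n → L.Term ι) (η : Fin m → S) :
    CDef L F S {v : ι → U | φ.Realize U (fun a => (σ (.inl a)).realize v)
      (fun i => (σ (.inr i)).realize v) η} := by
  refine ⟨φ.subst (fun a => (σ a).relabel .inl) (fun j => .inr (η j)), hφ.subst _ _, fun v => ?_⟩
  rw [PosFormula.realize_subst _ _ hφ]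
  simp [Function.comp_def]

theorem PosFormula.IsContinuous.cdef_holds {n : ℕ} {φ : PosFormula L F S Empty n 0}
    (hφ : φ.IsContinuous) : CDef L F S {v : Fin n → U | φ.Holds U v} := by
  have := hφ.cdef (U := U) (Sum.elim Empty.elim Term.var) Fin.elim0
  refine (congrArg (CDef L F S) ?_).mp this
  ext v
  simp only [mem_ofPred_eq, Holds]
  rw [Subsingleton.elim (fun a => _ : Empty → U) Empty.elim]
  rfl

namespace CDef

variable {ι ι' : Type*}

theorem congr {P Q : Set (ι → U)} (hP : CDef L F S P) (h : ∀ v, v ∈ Q ↔ v ∈ P) :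
    CDef L F S Q := by
  rwa [show Q = P from Set.ext h]

theorem exists_formula {n : ℕ} {P : Set (Fin n → U)} (hP : CDef L F S P) :
    ∃ φ : PosFormula L F S Empty n 0, φ.IsContinuous ∧ ∀ v, v ∈ P ↔ φ.Holds U v := by
  obtain ⟨φ, hφ, h⟩ := hP
  refine ⟨φ.subst (Sum.elim (fun i => .var (.inr i)) Fin.elim0) Fin.elim0, hφ.subst _ _,
    fun v => ?_⟩
  rw [h, PosFormula.Holds, PosFormula.realize_subst _ _ hφ]
  simp only [Sum.elim_inl, Term.realize_var, Sum.elim_inr]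
  rw [Subsingleton.elim (fun i : Fin 0 => _) Fin.elim0,
    Subsingleton.elim (fun i : Fin 0 => _) Fin.elim0]

theorem preimage {P : Set (ι → U)} (hP : CDef L F S P) (σ : ι → L.Term ι') :
    CDef L F S {v : ι' → U | (fun i => (σ i).realize v) ∈ P} := by
  obtain ⟨φ, hφ, h⟩ := hP
  refine (hφ.cdef (U := U) (Sum.elim σ Fin.elim0) Fin.elim0).congr fun v => ?_
  simp only [mem_ofPred_eq, h]
  rw [Subsingleton.elim (fun i : Fin 0 => _) Fin.elim0]
  rfl

theorem comp {P : Set (ι → U)} (hP : CDef L F S P) (f : ι → ι') :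
    CDef L F S {v : ι' → U | v ∘ f ∈ P} :=
  hP.preimage (fun i => .var (f i))

theorem inter {P Q : Set (ι → U)} (hP : CDef L F S P) (hQ : CDef L F S Q) :
    CDef L F S (P ∩ Q) := by
  obtain ⟨φ, hφ, h⟩ := hP
  obtain ⟨ψ, hψ, h'⟩ := hQ
  exact ⟨φ.and ψ, ⟨hφ, hψ⟩, fun v => and_congr (h v) (h' v)⟩

theorem union {P Q : Set (ι → U)} (hP : CDef L F S P) (hQ : CDef L F S Q) :
    CDef L F S (P ∪ Q) := by
  obtain ⟨φ, hφ, h⟩ := hP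
  obtain ⟨ψ, hψ, h'⟩ := hQ
  exact ⟨φ.or ψ, ⟨hφ, hψ⟩, fun v => or_congr (h v) (h' v)⟩

variable (L F S) in
theorem empty : CDef L F S (∅ : Set (ι → U)) :=
  ⟨.mem (k := 0) ⊥ Fin.elim0, trivial, fun _ => Iff.rfl⟩

variable (L F S) in
theorem univ : CDef L F S (univ : Set (ι → U)) :=
  ⟨.mem (k := 0) ⊤ Fin.elim0, trivial, fun _ => Iff.rfl⟩

theorem of_subsingleton [Subsingleton (ι → U)] (P : Set (ι → U)) : CDef L F S P := by
  rcases P.eq_empty_or_nonempty with rfl | h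
  · exact empty L F S
  · rw [Subsingleton.eq_univ_of_nonempty h]
    exact univ L F S

theorem biInter {P : ι' → Set (ι → U)} (hP : ∀ j, CDef L F S (P j)) {t : Set ι'}
    (ht : t.Finite) : CDef L F S (⋂ j ∈ t, P j) := by
  induction t, ht using Set.Finite.induction_on with
  | empty => simpa using univ L F S
  | insert _ _ ih => rw [biInter_insert]; exact (hP _).inter ih

theorem biUnion {P : ι' → Set (ι → U)} (hP : ∀ j, CDef L F S (P j)) {t : Set ι'}
    (ht : t.Finite) : CDef L F S (⋃ j ∈ t, P j) := by
  induction t, ht using Set.Finite.induction_on with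
  | empty => simpa using empty L F S
  | insert _ _ ih => rw [biUnion_insert]; exact (hP _).union ih

theorem exists_support {P : Set (ι → U)} (hP : CDef L F S P) :
    ∃ s : Finset ι, ∀ v v' : ι → U, (∀ i ∈ s, v i = v' i) → (v ∈ P ↔ v' ∈ P) := by
  obtain ⟨φ, hφ, h⟩ := hP
  obtain ⟨s, hs⟩ := PosFormula.exists_support (M := U) hφ
  exact ⟨s, fun v v' hv => by rw [h, h]; exact hs _ _ _ _ hv⟩

theorem forall_fin {k : ℕ} {P : Set (ι ⊕ Fin k → U)} (hP : CDef L F S P) :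
    CDef L F S {v : ι → U | ∀ z, Sum.elim v z ∈ P} := by
  obtain ⟨φ, hφ, h⟩ := hP
  have key : ∀ (k : ℕ) (ψ : PosFormula L F S ι k 0), ψ.IsContinuous →
      CDef L F S {v : ι → U | ∀ z, ψ.Realize U v z Fin.elim0} := by
    intro k
    induction k with
    | zero => exact fun ψ hψ => ⟨ψ, hψ, fun v => Unique.forall_iff⟩
    | succ k ih =>
      refine fun ψ hψ => (ih ψ.allH hψ).congr fun v => ⟨fun h z b => h _, fun h z => ?_⟩
      have := h (Fin.init z) (z (Fin.last k))
      rwa [Fin.snoc_init_self] at this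
  refine (key k _ (hφ.subst (Sum.elim (Sum.elim (fun i => .var (.inl i)) fun i => .var (.inr i))
    Fin.elim0) Fin.elim0)).congr fun v => forall_congr' fun z => ?_
  rw [h, PosFormula.realize_subst _ _ hφ]
  have : (fun a => Term.realize (Sum.elim v z) (Sum.elim (α := ι ⊕ Fin k) (β := Fin 0)
      (Sum.elim (fun i => (.var (.inl i) : L.Term (ι ⊕ Fin k))) fun i => .var (.inr i))
      Fin.elim0 (.inl a))) = Sum.elim v z := by
    funext a; cases a <;> rfl
  rw [this, Subsingleton.elim (fun i : Fin 0 => _) Fin.elim0,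
    Subsingleton.elim (fun i : Fin 0 => _) Fin.elim0]

theorem exists_fin {k : ℕ} {P : Set (ι ⊕ Fin k → U)} (hP : CDef L F S P) :
    CDef L F S {v : ι → U | ∃ z, Sum.elim v z ∈ P} := by
  obtain ⟨φ, hφ, h⟩ := hP
  have key : ∀ (k : ℕ) (ψ : PosFormula L F S ι k 0), ψ.IsContinuous →
      CDef L F S {v : ι → U | ∃ z, ψ.Realize U v z Fin.elim0} := by
    intro k
    induction k with
    | zero => exact fun ψ hψ => ⟨ψ, hψ, fun v => Unique.exists_iff⟩
    | succ k ih =>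
      refine fun ψ hψ => (ih ψ.exH hψ).congr fun v => ⟨fun ⟨z, hz⟩ => ?_, fun ⟨z, b, h⟩ => ⟨_, h⟩⟩
      refine ⟨Fin.init z, z (Fin.last k), ?_⟩
      rwa [Fin.snoc_init_self]
  refine (key k _ (hφ.subst (Sum.elim (Sum.elim (fun i => .var (.inl i)) fun i => .var (.inr i))
    Fin.elim0) Fin.elim0)).congr fun v => exists_congr fun z => ?_
  rw [h, PosFormula.realize_subst _ _ hφ]
  have : (fun a => Term.realize (Sum.elim v z) (Sum.elim (α := ι ⊕ Fin k) (β := Fin 0)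
      (Sum.elim (fun i => (.var (.inl i) : L.Term (ι ⊕ Fin k))) fun i => .var (.inr i))
      Fin.elim0 (.inl a))) = Sum.elim v z := by
    funext a; cases a <;> rfl
  rw [this, Subsingleton.elim (fun i : Fin 0 => _) Fin.elim0,
    Subsingleton.elim (fun i : Fin 0 => _) Fin.elim0]

/-- Only finitely many variables occur in a formula, so quantifying over a tuple indexed by any
type, even an infinite one, reduces to a finite tuple. -/
theorem exists_reindex [Nonempty U] {P : Set (ι ⊕ ι' → U)} (hP : CDef L F S P) :
    ∃ (k : ℕ) (f : ι' → Fin k), ∀ z : ι' → U, ∃ z' : Fin k → U, ∀ v : ι → U,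
      Sum.elim v z ∈ P ↔ Sum.elim v (z' ∘ f) ∈ P := by
  classical
  obtain ⟨s, hs⟩ := hP.exists_support
  let t : Finset ι' := s.preimage Sum.inr Sum.inr_injective.injOn
  let e := t.equivFin
  -- The extra last index receives all variables that do not occur; it also keeps the target of the
  -- reindexing nonempty.
  refine ⟨t.card + 1, fun j => if h : j ∈ t then (e ⟨j, h⟩).castSucc else Fin.last _,
    fun z => ⟨Fin.snoc (α := fun _ => U) (fun i => z (e.symm i)) (Classical.arbitrary U),
      fun v => hs _ _ ?_⟩⟩
  rintro (i | j) hj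
  · rfl
  · have hj' : j ∈ t := Finset.mem_preimage.2 hj
    simp [hj']

theorem forall_right {P : Set (ι ⊕ ι' → U)} (hP : CDef L F S P) :
    CDef L F S {v : ι → U | ∀ z, Sum.elim v z ∈ P} := by
  rcases isEmpty_or_nonempty U with hU | hU
  · exact of_subsingleton _
  obtain ⟨k, f, hf⟩ := hP.exists_reindex
  refine (hP.comp (Sum.map id f)).forall_fin.congr fun v => ⟨fun h z => ?_, fun h z => ?_⟩
  · simpa [Sum.elim_comp_map] using h (z ∘ f)
  · obtain ⟨z', hz'⟩ := hf z
    rw [hz' v]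
    simpa [Sum.elim_comp_map] using h z'

theorem exists_right {P : Set (ι ⊕ ι' → U)} (hP : CDef L F S P) :
    CDef L F S {v : ι → U | ∃ z, Sum.elim v z ∈ P} := by
  rcases isEmpty_or_nonempty U with hU | hU
  · exact of_subsingleton _
  obtain ⟨k, f, hf⟩ := hP.exists_reindex
  refine (hP.comp (Sum.map id f)).exists_fin.congr fun v => ⟨fun ⟨z, hz⟩ => ?_, fun ⟨z, hz⟩ => ?_⟩
  · obtain ⟨z', hz'⟩ := hf z
    refine ⟨z', ?_⟩
    rw [hz' v] at hz
    simpa [Sum.elim_comp_map] using hz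
  · refine ⟨z ∘ f, ?_⟩
    simpa [Sum.elim_comp_map] using hz

/-- The substitute for complements: `R` comes from a weakening that fails at `v`, and `Q` from the
strong negation between the formula and this weakening. -/
theorem exists_regular [CompactSpace S] [T2Space S] (hU : PosSaturated L F S U (Order.succ ℵ₀))
    [Countable ι] {P : Set (ι → U)} (hP : CDef L F S P) {v : ι → U} (hv : v ∉ P) :
    ∃ Q R : Set (ι → U), CDef L F S Q ∧ CDef L F S R ∧ P ⊆ Qᶜ ∧ Qᶜ ⊆ R ∧ v ∉ R := by
  obtain ⟨φ, hφ, h⟩ := hP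
  rw [h] at hv
  obtain ⟨φ', h1, h2⟩ := hU.exists_weakening_not_realize hφ hv
  obtain ⟨χ, hχ, h3⟩ := h1.exists_negation hφ
  exact ⟨{v | χ.Realize U v Fin.elim0 Fin.elim0}, {v | φ'.Realize U v Fin.elim0 Fin.elim0},
    ⟨χ, hχ, fun _ => Iff.rfl⟩, ⟨φ', h1.isContinuous hφ, fun _ => Iff.rfl⟩,
    fun v hv => (h3 U v _ _).1 ((h v).1 hv), fun v hv => (h3 U v _ _).2 hv, h2⟩

end CDef

theorem PosSaturated.exists_forall_mem (hU : PosSaturated L F S U (Order.succ ℵ₀))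
    {ι J : Type*} [Countable ι] (v : ι → U) {k : ℕ} {P : J → Set (ι ⊕ Fin k → U)}
    (hP : ∀ j, CDef L F S (P j))
    (h : ∀ t : Set J, t.Finite → ∃ z, ∀ j ∈ t, Sum.elim v z ∈ P j) :
    ∃ z, ∀ j, Sum.elim v z ∈ P j := by
  choose φ hφ hP' using hP
  let σ : (ι ⊕ Fin k) ⊕ Fin 0 → L.Term (ι ⊕ Fin (0 + k)) :=
    Sum.elim (Sum.elim (fun i => .var (.inl i)) fun i => .var (.inr (Fin.natAdd 0 i))) Fin.elim0
  have hreal : ∀ j (y : Fin k → U) (ζ : Fin 0 → S), ((φ j).subst σ (m' := 0) Fin.elim0).Realize U v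
      (Fin.append Fin.elim0 y) (Fin.append Fin.elim0 ζ) ↔ Sum.elim v y ∈ P j := by
    intro j y ζ
    rw [hP', PosFormula.realize_subst _ _ (hφ j)]
    have : (fun a => Term.realize (Sum.elim v (Fin.append Fin.elim0 y)) (σ (.inl a))) =
        Sum.elim v y := by
      funext a; cases a <;> simp [σ]
    rw [this, Subsingleton.elim (fun i : Fin 0 => _) Fin.elim0,
      Subsingleton.elim (fun i : Fin 0 => _) Fin.elim0]
  obtain ⟨y, ζ, hy⟩ := hU.exists_forall_realize (n := k) (m := 0) v Fin.elim0 Fin.elim0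
    (fun j => (φ j).subst σ (m' := 0) Fin.elim0) (fun j => (hφ j).subst _ _) (by
      intro t ht
      obtain ⟨z, hz⟩ := h t ht
      exact ⟨z, Fin.elim0, fun j hj => (hreal j z _).2 (hz j hj)⟩)
  exact ⟨y, fun j => (hreal j y ζ).1 (hy j)⟩

end Definable

open scoped Uniformity UniformConvergence

theorem pi_mem_uniformity {ι X : Type*} [Finite ι] [UniformSpace X] {V : Set ((ι → X) × (ι → X))}
    (hV : V ∈ 𝓤 (ι → X)) : ∃ W ∈ 𝓤 X, ∀ a b : ι → X, (∀ i, (a i, b i) ∈ W) → (a, b) ∈ V := by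
  rw [Pi.uniformity, Filter.mem_iInf_of_finite] at hV
  obtain ⟨t, ht, rfl⟩ := hV
  choose W hW hWt using fun i => Filter.mem_comap.1 (ht i)
  exact ⟨⋂ i, W i, Filter.iInter_mem.2 hW, fun a b h => mem_iInter.2 fun i =>
    hWt i (mem_iInter.1 (h i) i)⟩

theorem pi_eventually {ι X : Type*} [Finite ι] [UniformSpace X] {W : Set (X × X)} (hW : W ∈ 𝓤 X) :
    ∀ᶠ p in 𝓤 (ι → X), ∀ i, (p.1 i, p.2 i) ∈ W :=
  Filter.eventually_all.2 fun i => Pi.uniformContinuous_proj (fun _ : ι => X) i hW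

theorem snoc_eventually {U : Type*} [UniformSpace U] {n : ℕ}
    {P : (Fin (n + 1) → U) × (Fin (n + 1) → U) → Prop}
    (h : ∀ᶠ p in 𝓤 (Fin (n + 1) → U), P p) : ∀ᶠ p in 𝓤 (Fin n → U), ∀ b : U,
      P (Fin.snoc (α := fun _ => U) p.1 b, Fin.snoc (α := fun _ => U) p.2 b) := by
  obtain ⟨W, hW, h⟩ := pi_mem_uniformity h
  filter_upwards [pi_eventually hW] with p hp b
  refine h _ _ fun i => ?_
  refine Fin.lastCases ?_ (fun i => ?_) i
  · simpa using refl_mem_uniformity hW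
  · simpa using hp i

/-! ### Entourages and their definability. -/

section EntourageTopology

variable {L : FirstOrder.Language.{uf, ur}} {F : ℕ → ℕ → Type uF} {S : Type us}
  [TopologicalSpace S] {U : Type uU} [L.Structure U] [StandardStructure F S U]

open FirstOrder.Language (Term)

/-- Pull back an entourage along a map of variables. -/
def Entourage.comap {n n' : ℕ} (f : Fin n → Fin n') (ε : Entourage L F S n) :
    Entourage L F S n' where
  k := ε.k
  l := ε.l
  τ i := (ε.τ i).subst (fun a => .var (Sum.map f id a)) .inl
  D := ε.D
  isCompact_D := ε.isCompact_D
  D_mem := ε.D_mem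

theorem Entourage.rel_comap {n n' : ℕ} (f : Fin n → Fin n') (ε : Entourage L F S n)
    (x y : Fin n' → U) : (ε.comap f).Rel x y ↔ ε.Rel (x ∘ f) (y ∘ f) := by
  have : ∀ (x : Fin n' → U) (z : Fin ε.l → U), (fun a => Term.realize (Sum.elim x z)
      (.var (Sum.map f id a) : L.Term (Fin n' ⊕ Fin ε.l))) = Sum.elim (x ∘ f) z := by
    intro x z; funext a; cases a <;> rfl
  refine forall_congr' fun (z : Fin ε.l → U) => forall_congr' fun (i : Fin ε.k) => ?_
  simp only [comap, STerm.realize_subst]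
  rw [this x z, this y z]
  rfl

theorem Entourage.rel_refl {n : ℕ} (ε : Entourage L F S n) (x : Fin n → U) : ε.Rel x x :=
  fun _ _ => subset_of_mem_nhdsSet ε.D_mem rfl

theorem STerm.cdef_mem {ι : Type*} {k : ℕ} (t : Fin k → STerm L F S ι Empty)
    {C : Set (Fin k → S)} (hC : IsCompact C) :
    CDef L F S {v : ι → U | (fun i => (t i).realize v Empty.elim) ∈ C} := by
  have hc : (PosFormula.mem (n := 0) (m := 0) ⟨C, hC⟩ (fun i => (t i).subst (β' := Fin 0)
      (fun a => (.var (.inl a) : L.Term (ι ⊕ Fin 0))) Empty.elim)).IsContinuous := by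
    simp only [PosFormula.IsContinuous]
  refine (hc.cdef (U := U) (Sum.elim .var Fin.elim0) Fin.elim0).congr fun v => ?_
  have : (fun b : Empty => Sum.elim (Fin.elim0 : Fin 0 → S) id (Empty.elim b)) = Empty.elim :=
    Subsingleton.elim _ _
  simp only [PosFormula.Realize, mem_ofPred_eq, STerm.realize_subst, this]
  rfl

/-- A common refinement of two entourages. -/
def Entourage.inf [T2Space S] {n : ℕ} (ε δ : Entourage L F S n) : Entourage L F S n where
  k := ε.k + δ.k
  l := ε.l + δ.l
  τ := Fin.append
    (fun i => (ε.τ i).subst (fun a => .var (Sum.map id (Fin.castAdd _) a)) .inl)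
    (fun i => (δ.τ i).subst (fun a => .var (Sum.map id (Fin.natAdd _) a)) .inl)
  D := ε.D ∩ δ.D
  isCompact_D := ε.isCompact_D.inter δ.isCompact_D
  D_mem := Filter.inter_mem ε.D_mem δ.D_mem

theorem Entourage.rel_inf [T2Space S] {n : ℕ} {ε δ : Entourage L F S n} {x y : Fin n → U}
    (h : (ε.inf δ).Rel x y) : ε.Rel x y ∧ δ.Rel x y := by
  -- The merged entourage quantifies over both blocks of `z`, so the block that is not needed must
  -- be filled with some element `u`.
  rcases isEmpty_or_nonempty U with hU | ⟨⟨u⟩⟩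
  · rw [Subsingleton.elim y x]
    exact ⟨ε.rel_refl x, δ.rel_refl x⟩
  refine ⟨fun z i => ?_, fun z i => ?_⟩
  · have := (h (Fin.append z fun _ => u) (Fin.castAdd _ i)).1
    simp only [inf, Fin.append_left, STerm.realize_subst, Term.realize_var] at this
    convert this using 3 <;>
    · funext a
      cases a <;> simp
  · have := (h (Fin.append (fun _ => u) z) (Fin.natAdd _ i)).2
    simp only [inf, Fin.append_right, STerm.realize_subst, Term.realize_var] at this
    convert this using 3 <;>
    · funext a
      cases a <;> simp

variable [CompactSpace S]

theorem STerm.cdef_pair {ι : Type*} (t t' : STerm L F S ι Empty)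
    {D : Set (S × S)} (hD : IsClosed D) :
    CDef L F S {v : ι → U | (t.realize v Empty.elim, t'.realize v Empty.elim) ∈ D} := by
  have hC : IsClosed {s : Fin 2 → S | (s 0, s 1) ∈ D} :=
    hD.preimage (by fun_prop)
  exact (STerm.cdef_mem (U := U) ![t, t'] hC.isCompact).congr fun v => Iff.rfl

theorem Entourage.cdef_pair {n : ℕ} (ε : Entourage L F S n) (i : Fin ε.k) {D : Set (S × S)}
    (hD : IsClosed D) : CDef L F S {v : (Fin n ⊕ Fin n) ⊕ Fin ε.l → U |
      ((ε.τ i).realize (Sum.elim (v ∘ .inl ∘ .inl) (v ∘ .inr)) Empty.elim,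
        (ε.τ i).realize (Sum.elim (v ∘ .inl ∘ .inr) (v ∘ .inr)) Empty.elim) ∈ D} := by
  refine (STerm.cdef_pair (U := U)
    ((ε.τ i).subst (α' := (Fin n ⊕ Fin n) ⊕ Fin ε.l) (fun a => .var (Sum.map .inl id a)) .inl)
    ((ε.τ i).subst (α' := (Fin n ⊕ Fin n) ⊕ Fin ε.l) (fun a => .var (Sum.map .inr id a)) .inl)
    hD).congr fun v => ?_
  simp only [mem_ofPred_eq, STerm.realize_subst, Term.realize_var]
  have h (f : Fin n → Fin n ⊕ Fin n) : (fun a : Fin n ⊕ Fin ε.l =>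
      v (Sum.map f id a)) = Sum.elim (v ∘ .inl ∘ f) (v ∘ .inr) := by
    funext a; cases a <;> rfl
  rw [h .inl, h .inr]
  rfl

theorem Entourage.cdef_rel [T2Space S] {n : ℕ} (ε : Entourage L F S n) :
    CDef L F S {v : Fin n ⊕ Fin n → U | ε.Rel (v ∘ .inl) (v ∘ .inr)} := by
  refine (CDef.biInter (U := U) (fun i : Fin ε.k => ε.cdef_pair i ε.isCompact_D.isClosed)
    finite_univ).forall_right.congr fun v => forall_congr' fun z => ?_
  simp only [biInter_univ, mem_iInter]
  rfl

/-- Counterpart of `Entourage.cdef_rel`: an entourage contains one with definable complement.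
Shrinking `D` to its interior is what makes the negated condition closed. -/
theorem Entourage.cdef_not_rel_interior {n : ℕ} (ε : Entourage L F S n) :
    CDef L F S {v : Fin n ⊕ Fin n → U | ∃ z : Fin ε.l → U, ∃ i,
      ((ε.τ i).realize (Sum.elim (v ∘ .inl) z) Empty.elim,
        (ε.τ i).realize (Sum.elim (v ∘ .inr) z) Empty.elim) ∈ (interior ε.D)ᶜ} := by
  refine (CDef.biUnion (U := U) (fun i : Fin ε.k => ε.cdef_pair i
    (isOpen_interior (s := ε.D)).isClosed_compl) finite_univ).exists_right.congr fun v =>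
      exists_congr fun z => ?_
  simp only [biUnion_univ, mem_iUnion]
  rfl

variable (L F S) in
/-- The trivial entourage. -/
def Entourage.top (n : ℕ) : Entourage L F S n where
  k := 0
  l := 0
  τ := Fin.elim0
  D := univ
  isCompact_D := isCompact_univ
  D_mem := Filter.univ_mem

variable [T2Space S]

theorem Entourage.exists_le_of_finite {n : ℕ} {J : Type*} (ε : J → Entourage L F S n) {t : Set J}
    (ht : t.Finite) : ∃ δ : Entourage L F S n, ∀ x y : Fin n → U, δ.Rel x y →
      ∀ j ∈ t, (ε j).Rel x y := by
  induction t, ht using Set.Finite.induction_on with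
  | empty => exact ⟨top L F S n, by simp⟩
  | @insert a _ _ _ ih =>
    obtain ⟨δ, hδ⟩ := ih
    refine ⟨(ε a).inf δ, fun x y h => ?_⟩
    rintro j (rfl | hj)
    · exact (rel_inf h).1
    · exact hδ x y (rel_inf h).2 j hj

variable (L F S) (U) in
/-- The filter on pairs of `n`-tuples generated by the entourages. -/
def entourageFilter (n : ℕ) : Filter ((Fin n → U) × (Fin n → U)) where
  sets := {V | ∃ ε : Entourage L F S n, ∀ x y, ε.Rel x y → (x, y) ∈ V}
  univ_sets := ⟨Entourage.top L F S n, fun _ _ _ => trivial⟩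
  sets_of_superset := fun ⟨ε, h⟩ hs => ⟨ε, fun x y hxy => hs (h x y hxy)⟩
  inter_sets := fun ⟨ε, h⟩ ⟨δ, h'⟩ => ⟨ε.inf δ, fun x y hxy =>
    ⟨h x y (Entourage.rel_inf hxy).1, h' x y (Entourage.rel_inf hxy).2⟩⟩

end EntourageTopology

/-! ### The uniformity on the home sort; uniform continuity of terms and formulas. -/

section Uniformity

variable {L : FirstOrder.Language.{uf, ur}} {F : ℕ → ℕ → Type uF} {S : Type us}
  [UniformSpace S] {U : Type uU} [L.Structure U] [StandardStructure F S U]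

open FirstOrder.Language (Term)

variable (L F S U) in
/-- A uniform structure on the home sort is compatible if it is generated by the entourages. -/
class CompatibleUniformity [UniformSpace U] : Prop where
  rel_mem : ∀ ε : Entourage L F S 1, {p : U × U | ε.Rel (fun _ => p.1) (fun _ => p.2)} ∈ 𝓤 U
  exists_rel : ∀ V ∈ 𝓤 U, ∃ ε : Entourage L F S 1, ∀ x y : U,
    ε.Rel (fun _ => x) (fun _ => y) → (x, y) ∈ V

variable [CompactSpace S]

theorem exists_isCompact_mem_nhdsSet_diagonal {V : Set (S × S)} (hV : V ∈ 𝓤 S) :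
    ∃ D ⊆ V, IsCompact D ∧ D ∈ 𝓝ˢ (diagonal S) := by
  obtain ⟨D, hD, hDV⟩ := uniformity_hasBasis_closed.mem_iff.1 hV
  exact ⟨D, hDV, hD.2.isCompact, by rw [nhdsSet_diagonal_eq_uniformity]; exact hD.1⟩

variable [T2Space S]

variable (L F S U) in
/-- The uniform structure on the home sort generated by the entourages. -/
@[reducible] def homeUniformity : UniformSpace U :=
  ⨅ τ : Σ l, STerm L F S (Fin 1 ⊕ Fin l) Empty, UniformSpace.comap
    (fun x => UniformFun.ofFun (fun z : Fin τ.1 → U =>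
      τ.2.realize (Sum.elim (fun _ : Fin 1 => x) z) Empty.elim)) inferInstance

/-- Each term `τ` contributes uniform convergence of `z ↦ τ(x, z)`, which is exactly what a one-term
entourage controls. -/
theorem compatibleUniformity_homeUniformity :
    @CompatibleUniformity L F S _ U _ _ (homeUniformity L F S U) := by
  let _ := homeUniformity L F S U
  have h𝓤 : 𝓤 U = ⨅ τ : Σ l, STerm L F S (Fin 1 ⊕ Fin l) Empty, Filter.comap
      (fun p : U × U => (UniformFun.ofFun (fun z : Fin τ.1 → U =>
      τ.2.realize (Sum.elim (fun _ : Fin 1 => p.1) z) Empty.elim), UniformFun.ofFun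
      (fun z : Fin τ.1 → U => τ.2.realize (Sum.elim (fun _ : Fin 1 => p.2) z) Empty.elim)))
      (𝓤 ((Fin τ.1 → U) →ᵤ S)) := by
    change 𝓤[homeUniformity L F S U] = _
    rw [homeUniformity, iInf_uniformity]
    rfl
  constructor
  · intro ε
    have : {p : U × U | ε.Rel (fun _ => p.1) (fun _ => p.2)} = ⋂ i, {p : U × U | ∀ z : Fin ε.l → U,
        ((ε.τ i).realize (Sum.elim (fun _ => p.1) z) Empty.elim,
          (ε.τ i).realize (Sum.elim (fun _ => p.2) z) Empty.elim) ∈ ε.D} := by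
      ext p
      simp only [Entourage.Rel, mem_ofPred_eq, mem_iInter]
      exact forall_comm
    rw [this, Filter.iInter_mem]
    intro i
    rw [h𝓤]
    refine Filter.mem_iInf_of_mem ⟨ε.l, ε.τ i⟩ ⟨_, (UniformFun.hasBasis_uniformity _ _).mem_of_mem
      (i := ε.D) (by rw [← nhdsSet_diagonal_eq_uniformity]; exact ε.D_mem), ?_⟩
    exact fun p hp => hp
  · intro V hV
    -- Entourages have common refinements, so they form a filter, and it is enough to test the
    -- generators of the infimum one by one.
    suffices h : Filter.map (fun p : (Fin 1 → U) × (Fin 1 → U) => (p.1 0, p.2 0))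
        (entourageFilter L F S U 1) ≤ 𝓤 U by
      obtain ⟨ε, hε⟩ := h hV
      exact ⟨ε, fun x y hxy => hε _ _ hxy⟩
    rw [h𝓤]
    refine le_iInf fun τ => ?_
    rw [← Filter.map_le_iff_le_comap, (UniformFun.hasBasis_uniformity _ _).ge_iff]
    intro W hW
    obtain ⟨D, hDW, hD, hD'⟩ := exists_isCompact_mem_nhdsSet_diagonal hW
    refine ⟨⟨1, τ.1, fun _ => τ.2, D, hD, hD'⟩, fun x y hxy z => hDW ?_⟩
    have hx : ∀ x : Fin 1 → U, (fun _ => x 0) = x := fun x => by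
      funext i; rw [Subsingleton.elim i 0]
    have := hxy z 0
    simp only [UniformFun.toFun_ofFun, hx]
    exact this

/-- Terms are equicontinuous in their variables of sort `S`, uniformly in the home variables:
continuous functions by compactness of `S`, symbols of `F` by assumption. -/
theorem STerm.exists_uniformity {α β : Type*} [Finite β] (t : STerm L F S α β) {V : Set (S × S)}
    (hV : V ∈ 𝓤 S) : ∃ W ∈ 𝓤 (β → S), ∀ w w' : β → S, (w, w') ∈ W → ∀ v : α → U,
      (t.realize v w, t.realize v w') ∈ V := by
  induction t generalizing V with
  | var b => exact ⟨_, Pi.uniformContinuous_proj (fun _ : β => S) b hV, fun w w' h v => h⟩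
  | cont f t ih =>
    obtain ⟨W₀, hW₀, h₀⟩ := pi_mem_uniformity
      (CompactSpace.uniformContinuous_of_continuous f.continuous hV)
    choose W hW h using fun i => ih i hW₀
    exact ⟨⋂ i, W i, Filter.iInter_mem.2 hW, fun w w' hw v => h₀ _ _ fun i =>
      h i w w' (mem_iInter.1 hw i) v⟩
  | @app n m g r t ih =>
    obtain ⟨D, hDV, hD, hD'⟩ := exists_isCompact_mem_nhdsSet_diagonal hV
    obtain ⟨E, hE, hdiag, hg⟩ := StandardStructure.equicontinuous (M := U) g D hD.isClosed hD'
    obtain ⟨W₀, hW₀, h₀⟩ := pi_mem_uniformity (V := E)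
      (by rw [← nhdsSet_diagonal_eq_uniformity]; exact hE.mem_nhdsSet.2 hdiag)
    choose W hW h using fun i => ih i hW₀
    exact ⟨⋂ i, W i, Filter.iInter_mem.2 hW, fun w w' hw v => hDV (hg _ _ _ (h₀ _ _ fun i =>
      h i w w' (mem_iInter.1 hw i) v))⟩

variable [UniformSpace U] [CompatibleUniformity L F S U]

omit [T2Space S] in
-- The uniformity is defined by changing a single element, so a tuple is changed one coordinate at a
-- time, with errors composed by the triangle inequality.
theorem STerm.eventually_uniformity {n l : ℕ} (τ : STerm L F S (Fin n ⊕ Fin l) Empty)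
    {V : Set (S × S)} (hV : V ∈ 𝓤 S) : ∀ᶠ p in 𝓤 (Fin n → U), ∀ z : Fin l → U,
      (τ.realize (Sum.elim p.1 z) Empty.elim, τ.realize (Sum.elim p.2 z) Empty.elim) ∈ V := by
  suffices h : ∀ (s : Finset (Fin n)) (V : Set (S × S)), V ∈ 𝓤 S → ∃ W ∈ 𝓤 U, ∀ x y : Fin n → U,
      (∀ i ∈ s, (x i, y i) ∈ W) → (∀ i ∉ s, x i = y i) → ∀ z : Fin l → U,
      (τ.realize (Sum.elim x z) Empty.elim, τ.realize (Sum.elim y z) Empty.elim) ∈ V by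
    obtain ⟨W, hW, h⟩ := h Finset.univ V hV
    filter_upwards [pi_eventually hW] with p hp
    exact h _ _ (fun i _ => hp i) (by simp)
  intro s
  induction s using Finset.induction_on with
  | empty =>
    refine fun V hV => ⟨_, Filter.univ_mem, fun x y _ h z => ?_⟩
    rw [show x = y from funext fun i => h i (by simp)]
    exact refl_mem_uniformity hV
  | insert i s hi ih =>
    intro V hV
    obtain ⟨V₁, hV₁, hVV⟩ := comp_mem_uniformity_sets hV
    obtain ⟨W₁, hW₁, h₁⟩ := ih V₁ hV₁
    -- The moving coordinate `i` is the only main variable; the frozen coordinates join `z`, over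
    -- which entourages are uniform.
    let τ' : STerm L F S (Fin 1 ⊕ Fin (n + l)) Empty := τ.subst (Sum.elim
      (fun j => .var (if j = i then .inl 0 else .inr (Fin.castAdd l j)))
      (fun k => .var (.inr (Fin.natAdd n k)))) .inl
    have hτ' : ∀ (x : Fin n → U) (a : U) (z : Fin l → U),
        τ'.realize (Sum.elim (fun _ => a) (Fin.append x z)) Empty.elim =
          τ.realize (Sum.elim (Function.update x i a) z) Empty.elim := by
      intro x a z
      simp only [τ', STerm.realize_subst]
      congr 1
      funext j
      rcases j with j | j
      · by_cases hj : j = i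
        · subst hj; simp
        · simp [hj]
      · simp
    obtain ⟨D, hDV, hD, hD'⟩ := exists_isCompact_mem_nhdsSet_diagonal hV₁
    refine ⟨_, Filter.inter_mem hW₁ (CompatibleUniformity.rel_mem (U := U)
      (⟨1, _, fun _ => τ', D, hD, hD'⟩ : Entourage L F S 1)), fun x y hxy hxy' z => hVV ?_⟩
    refine ⟨τ.realize (Sum.elim (Function.update x i (y i)) z) Empty.elim, ?_, ?_⟩
    · have := (hxy i (Finset.mem_insert_self _ _)).2 (Fin.append x z) 0
      simp only [hτ', Function.update_eq_self] at this
      exact hDV this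
    · refine h₁ _ _ (fun j hj => ?_) (fun j hj => ?_) z
      · have hji : j ≠ i := fun h => hi (h ▸ hj)
        rw [Function.update_of_ne hji]
        exact (hxy j (Finset.mem_insert_of_mem hj)).1
      · by_cases hji : j = i
        · subst hji; simp
        · rw [Function.update_of_ne hji]
          exact hxy' j (by simp [hji, hj])

omit [T2Space S] in
theorem Entourage.rel_mem {n : ℕ} (ε : Entourage L F S n) :
    ∀ᶠ p in 𝓤 (Fin n → U), ε.Rel p.1 p.2 := by
  have : ∀ᶠ p in 𝓤 (Fin n → U), ∀ i, ∀ z : Fin ε.l → U,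
      ((ε.τ i).realize (Sum.elim p.1 z) Empty.elim,
        (ε.τ i).realize (Sum.elim p.2 z) Empty.elim) ∈ ε.D :=
    Filter.eventually_all.2 fun i => (ε.τ i).eventually_uniformity
      (by rw [← nhdsSet_diagonal_eq_uniformity]; exact ε.D_mem)
  exact this.mono fun p hp z i => hp i z

variable (L F S) in
-- With `Entourage.rel_mem` this shows that entourages on `n`-tuples generate the product
-- uniformity.
theorem exists_entourage_rel {n : ℕ} {V : Set ((Fin n → U) × (Fin n → U))}
    (hV : V ∈ 𝓤 (Fin n → U)) :
    ∃ ε : Entourage L F S n, ∀ x y, ε.Rel x y → (x, y) ∈ V := by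
  obtain ⟨W, hW, h⟩ := pi_mem_uniformity hV
  obtain ⟨ε, hε⟩ := CompatibleUniformity.exists_rel (L := L) (F := F) (S := S) W hW
  obtain ⟨δ, hδ⟩ := Entourage.exists_le_of_finite (U := U)
    (fun i : Fin n => ε.comap fun _ : Fin 1 => i) finite_univ
  exact ⟨δ, fun x y hxy => h x y fun i => hε _ _
    ((ε.rel_comap _ x y).1 (hδ x y hxy i (mem_univ _)))⟩

variable (L F S) in
theorem exists_cdef_subset {n : ℕ} {V : Set ((Fin n → U) × (Fin n → U))}
    (hV : V ∈ 𝓤 (Fin n → U)) : ∃ Q : Set (Fin n ⊕ Fin n → U), CDef L F S Q ∧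
      (∀ᶠ p in 𝓤 (Fin n → U), Sum.elim p.1 p.2 ∈ Q) ∧
      ∀ x y : Fin n → U, Sum.elim x y ∈ Q → (x, y) ∈ V := by
  obtain ⟨ε, hε⟩ := exists_entourage_rel L F S hV
  exact ⟨_, ε.cdef_rel, ε.rel_mem, fun x y hxy => hε _ _ hxy⟩

variable (L F S) in
theorem exists_cdef_compl_subset {n : ℕ} {V : Set ((Fin n → U) × (Fin n → U))}
    (hV : V ∈ 𝓤 (Fin n → U)) : ∃ G : Set (Fin n ⊕ Fin n → U), CDef L F S G ∧
      (∀ᶠ p in 𝓤 (Fin n → U), Sum.elim p.1 p.2 ∉ G) ∧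
      ∀ x y : Fin n → U, Sum.elim x y ∉ G → (x, y) ∈ V := by
  obtain ⟨ε, hε⟩ := exists_entourage_rel L F S hV
  have hD : interior ε.D ∈ 𝓤 S := by
    rw [← nhdsSet_diagonal_eq_uniformity]
    exact isOpen_interior.mem_nhdsSet.2 (subset_interior_iff_mem_nhdsSet.2 ε.D_mem)
  refine ⟨_, ε.cdef_not_rel_interior, ?_, fun x y hxy => hε _ _ fun z i => ?_⟩
  · filter_upwards [Filter.eventually_all.2 fun i => (ε.τ i).eventually_uniformity (U := U) hD]
      with p hp
    rintro ⟨z, i, hz⟩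
    exact hz (hp i z)
  · by_contra hc
    exact hxy ⟨z, i, fun h => hc (interior_subset h)⟩

/-- Uniformity in `η` by compactness: closeness at finitely many `η₀`, then two further steps from
`η` to `η₀` and back by equicontinuity. -/
theorem STerm.eventually_uniformity_forall {n m : ℕ} (t : STerm L F S (Empty ⊕ Fin n) (Fin m))
    {V : Set (S × S)} (hV : V ∈ 𝓤 S) : ∀ᶠ p in 𝓤 (Fin n → U), ∀ η : Fin m → S,
      (t.realize (Sum.elim Empty.elim p.1) η, t.realize (Sum.elim Empty.elim p.2) η) ∈ V := by
  obtain ⟨V₁, hV₁, hsymm, hVV⟩ := comp_comp_symm_mem_uniformity_sets hV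
  obtain ⟨W, hW, h⟩ := t.exists_uniformity (U := U) hV₁
  obtain ⟨s, -, hs⟩ := (isCompact_univ (X := Fin m → S)).elim_nhds_subcover
    (fun η => UniformSpace.ball η W) fun η _ => UniformSpace.ball_mem_nhds η hW
  have key : ∀ η : Fin m → S, ∀ᶠ p in 𝓤 (Fin n → U),
      (t.realize (Sum.elim Empty.elim p.1) η, t.realize (Sum.elim Empty.elim p.2) η) ∈ V₁ := by
    intro η
    let t' : STerm L F S (Fin n ⊕ Fin 0) Empty :=
      t.subst (Sum.elim Empty.elim fun i => .var (.inl i)) fun j => .inr (η j)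
    filter_upwards [t'.eventually_uniformity (U := U) hV₁] with p hp
    have hr : ∀ x : Fin n → U, t'.realize (Sum.elim x Fin.elim0) Empty.elim =
        t.realize (Sum.elim Empty.elim x) η := by
      intro x
      simp only [t', STerm.realize_subst]
      congr 1
      funext a
      rcases a with a | a
      · exact a.elim
      · rfl
    rw [← hr, ← hr]
    exact hp _
  filter_upwards [(Filter.eventually_all_finset s).2 fun η _ => key η] with p hp η
  obtain ⟨η₀, hη₀, hη⟩ := mem_iUnion₂.1 (hs (mem_univ η))
  have h1 := h _ _ hη
  exact hVV ⟨_, ⟨_, SetRel.symm V₁ (h1 _), hp η₀ hη₀⟩, h1 _⟩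

/-- Uniform continuity of formulas: a small perturbation of the tuple costs no more than a
weakening. For atoms this is the uniform continuity of terms together with compactness of `C`;
quantified variables are not moved. -/
theorem PosFormula.Weakening.eventually_realize {n m : ℕ} {φ φ' : PosFormula L F S Empty n m}
    (h : φ.Weakening φ') (hφ : φ.IsContinuous) : ∀ᶠ p in 𝓤 (Fin n → U), ∀ η : Fin m → S,
      φ.Realize U Empty.elim p.1 η → φ'.Realize U Empty.elim p.2 η := by
  induction h with
  | home => exact hφ.elim
  | @mem n m k C C' t h =>
    obtain ⟨V, hV, hVC⟩ := (C.isCompact.nhdsSet_basis_uniformity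
      (𝓤 (Fin k → S)).basis_sets).mem_iff.1 h
    obtain ⟨W, hW, hWV⟩ := pi_mem_uniformity hV
    filter_upwards [Filter.eventually_all.2 fun i =>
      (t i).eventually_uniformity_forall (U := U) hW] with p hp η hx
    exact hVC (mem_iUnion₂.2 ⟨_, hx, hWV _ _ fun i => hp i η⟩)
  | and _ _ ih ih' =>
    filter_upwards [ih hφ.1, ih' hφ.2] with p h1 h2 η h
    exact ⟨h1 η h.1, h2 η h.2⟩
  | or _ _ ih ih' =>
    filter_upwards [ih hφ.1, ih' hφ.2] with p h1 h2 η h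
    exact h.imp (h1 η) (h2 η)
  | allH _ ih =>
    filter_upwards [snoc_eventually (ih hφ)] with p hp η h b
    exact hp b η (h b)
  | exH _ ih =>
    filter_upwards [snoc_eventually (ih hφ)] with p hp η h
    exact h.imp fun b => hp b η
  | allS _ ih =>
    filter_upwards [ih hφ] with p hp η h s
    exact hp _ (h s)
  | exS _ ih =>
    filter_upwards [ih hφ] with p hp η h
    exact h.imp fun s => hp _

end Uniformity

/-! ### Consequences of separability and saturation. -/

section Saturated

variable {L : FirstOrder.Language.{uf, ur}} {F : ℕ → ℕ → Type uF} {S : Type us}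
  [UniformSpace S] [CompactSpace S] [T2Space S] {U : Type uU} [L.Structure U]
  [StandardStructure F S U]

open FirstOrder.Language (Term)

/-- Apply density in `U` itself, to a weakening that fails at `x`: every definable set is an
intersection of members of a countable family. -/
theorem ContinuousSeparable.exists_countable_cdef (hU : PosSaturated L F S U (Order.succ ℵ₀))
    (hsep : ContinuousSeparable L F S U) :
    ∃ H : ∀ n, Set (Set (Fin n → U)), (∀ n, (H n).Countable) ∧
      (∀ n, ∀ Q ∈ H n, CDef L F S Q) ∧ ∀ n (P : Set (Fin n → U)), CDef L F S P → ∀ x ∉ P,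
        ∃ Q ∈ H n, P ⊆ Q ∧ x ∉ Q := by
  obtain ⟨H, hH, hc, hd⟩ := hsep
  refine ⟨fun n => (fun ψ : PosFormula L F S Empty n 0 => {v | ψ.Holds U v}) '' {ψ | ⟨n, ψ⟩ ∈ H},
    fun n => ((hH.preimage (f := Sigma.mk n) sigma_mk_injective :)).image _, ?_, ?_⟩
  · rintro n _ ⟨ψ, hψ, rfl⟩
    exact (hc _ hψ).cdef_holds
  · intro n P hP x hx
    obtain ⟨φ, hφ, h⟩ := hP.exists_formula
    obtain ⟨φ', h1, h2⟩ := hU.exists_weakening_not_realize hφ (fun h' => hx ((h x).2 h'))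
    obtain ⟨ψ, hψ, h3⟩ := hd n φ φ' hφ h1
    have h4 := h3 U (fun θ hθ => hθ)
    exact ⟨_, ⟨ψ, hψ, rfl⟩, fun v hv => (h4 v).1 ((h v).1 hv), fun h => h2 ((h4 x).2 h)⟩

section Uniform

variable [UniformSpace U] [CompatibleUniformity L F S U]

theorem CDef.isClosed (hU : PosSaturated L F S U (Order.succ ℵ₀)) {n : ℕ} {P : Set (Fin n → U)}
    (hP : CDef L F S P) : IsClosed P := by
  obtain ⟨φ, hφ, h⟩ := hP.exists_formula
  rw [← isOpen_compl_iff, isOpen_iff_mem_nhds]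
  intro x hx
  obtain ⟨φ', h1, h2⟩ := hU.exists_weakening_not_realize hφ (fun h' => hx ((h x).2 h'))
  filter_upwards [mem_nhds_right x (h1.eventually_realize (U := U) hφ)] with y hy hyP
  exact h2 (hy _ ((h y).1 hyP))

omit [CompactSpace S] [T2Space S] in
theorem cauchyCompletion_eq_closure (A : Set U) : cauchyCompletion L F S A = closure A := by
  ext a
  rw [UniformSpace.mem_closure_iff_ball]
  constructor
  · intro h V hV
    obtain ⟨ε, hε⟩ := CompatibleUniformity.exists_rel (L := L) (F := F) (S := S) V hV
    obtain ⟨x, hx, hxε⟩ := h {ε} (finite_singleton _)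
    exact ⟨x, hε _ _ (hxε ε rfl), hx⟩
  · intro h E hE
    obtain ⟨x, hx, hxA⟩ := h ((Filter.biInter_mem hE).2 fun ε _ =>
      CompatibleUniformity.rel_mem (U := U) ε)
    exact ⟨x, hxA, fun ε hε => mem_iInter₂.1 hx ε hε⟩

variable (L F S) in
theorem exists_cdef_two_subset {V : Set (U × U)} (hV : V ∈ 𝓤 U) :
    ∃ Q : Set (Fin 2 → U), CDef L F S Q ∧ {p : U × U | ![p.1, p.2] ∈ Q} ∈ 𝓤 U ∧
      ∀ x y, ![x, y] ∈ Q → (x, y) ∈ V := by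
  obtain ⟨ε, hε⟩ := CompatibleUniformity.exists_rel (L := L) (F := F) (S := S) V hV
  have key : ∀ x y : U, (![x, y] ∘ Sum.elim (fun _ : Fin 1 => 0) (fun _ : Fin 1 => 1)) ∈
      {v : Fin 1 ⊕ Fin 1 → U | ε.Rel (v ∘ .inl) (v ∘ .inr)} ↔
        ε.Rel (fun _ => x) (fun _ => y) := fun x y => Iff.rfl
  refine ⟨_, ε.cdef_rel.comp (Sum.elim (fun _ : Fin 1 => 0) (fun _ : Fin 1 => 1)), ?_,
    fun x y h => hε x y ((key x y).1 h)⟩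
  exact Filter.mem_of_superset (CompatibleUniformity.rel_mem (U := U) ε)
    fun p hp => (key p.1 p.2).2 hp

variable (L F S) in
theorem exists_cdef_two_compl_subset {V : Set (U × U)} (hV : V ∈ 𝓤 U) :
    ∃ G : Set (Fin 2 → U), CDef L F S G ∧ {p : U × U | ![p.1, p.2] ∉ G} ∈ 𝓤 U ∧
      ∀ x y, ![x, y] ∉ G → (x, y) ∈ V := by
  obtain ⟨G, hG, h1, h2⟩ := exists_cdef_compl_subset L F S (n := 1)
    (V := {p | (p.1 0, p.2 0) ∈ V}) (Pi.uniformContinuous_proj (fun _ : Fin 1 => U) 0 hV)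
  have key : ∀ x y : U, (![x, y] ∘ Sum.elim (fun _ : Fin 1 => 0) (fun _ : Fin 1 => 1)) =
      Sum.elim (fun _ => x) (fun _ => y) := by
    intro x y
    funext i
    rcases i with i | i <;> rfl
  refine ⟨_, hG.comp (Sum.elim (fun _ : Fin 1 => 0) (fun _ : Fin 1 => 1)), ?_, fun x y h => ?_⟩
  · have hu : UniformContinuous fun (x : U) (_ : Fin 1) => x :=
      uniformContinuous_pi.2 fun _ => uniformContinuous_id
    refine Filter.mem_of_superset (hu h1) fun p hp => ?_
    simp only [mem_ofPred_eq, key]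
    exact hp
  · simp only [mem_ofPred_eq, key] at h
    exact h2 _ _ h

/-- The entourages among the countably many sets in `H 2` generate. A definable entourage `Q`
disjoint from `G` is an intersection of sets of `H 2`, and by compactness finitely many of these are
already disjoint from `G`. -/
theorem isCountablyGenerated_uniformity (hU : PosSaturated L F S U (Order.succ ℵ₀))
    (hsep : ContinuousSeparable L F S U) : (𝓤 U).IsCountablyGenerated := by
  obtain ⟨H, hH, hHc, hHd⟩ := hsep.exists_countable_cdef hU
  let pairs : Set (Fin 2 → U) → Set (U × U) := fun Q => {p | ![p.1, p.2] ∈ Q}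
  refine ⟨⟨{V | ∃ Q ∈ H 2, V = pairs Q ∧ V ∈ 𝓤 U},
    ((hH 2).image pairs).mono fun V hV => by
      obtain ⟨Q, hQ, h, _⟩ := hV; exact ⟨Q, hQ, h.symm⟩, ?_⟩⟩
  refine le_antisymm (Filter.le_generate_iff.2 fun V hV => by
    obtain ⟨_, _, _, h⟩ := hV; exact h) fun V hV => ?_
  obtain ⟨G, hG, hG𝓤, hGV⟩ := exists_cdef_two_compl_subset L F S hV
  obtain ⟨Q, hQ, hQ𝓤, hQG⟩ := exists_cdef_two_subset L F S hG𝓤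
  let J := {Q' : Set (Fin 2 → U) // Q' ∈ H 2 ∧ Q ⊆ Q'}
  obtain ⟨t, ht, htG⟩ : ∃ t : Set J, t.Finite ∧ ∀ z, (∀ j ∈ t, z ∈ j.1) → z ∉ G := by
    by_contra! hc
    have hJ : ∀ j : Option J, CDef L F S (j.elim G Subtype.val) := by
      rintro (_ | j)
      · exact hG
      · exact hHc 2 _ j.2.1
    obtain ⟨z, hz⟩ := hU.exists_forall_mem (ι := Empty) (k := 2) (Empty.elim : Empty → U)
      (fun j : Option J => (hJ j).comp .inr) (by
        intro t ht
        obtain ⟨z, hz, hzG⟩ := hc (some ⁻¹' t) (ht.preimage (Option.some_injective _).injOn)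
        refine ⟨z, ?_⟩
        rintro (_ | j) hj
        · exact hzG
        · exact hz j hj)
    have hzQ : z ∈ Q := by
      by_contra hzQ
      obtain ⟨Q', hQ', h1, h2⟩ := hHd 2 Q hQ z hzQ
      exact h2 (hz (some ⟨Q', hQ', h1⟩))
    have hz' : z = ![z 0, z 1] := by
      funext i; fin_cases i <;> rfl
    rw [hz'] at hzQ
    refine hQG _ _ hzQ ?_
    change ![z 0, z 1] ∈ G
    rw [← hz']
    exact hz none
  refine Filter.mem_generate_iff.2 ⟨(fun j : J => pairs j.1) '' t, ?_, ht.image _, ?_⟩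
  · rintro _ ⟨j, -, rfl⟩
    exact ⟨j.1, j.2.1, rfl, Filter.mem_of_superset hQ𝓤 fun p hp => j.2.2 hp⟩
  · intro p hp
    exact hGV p.1 p.2 (htG _ fun j hj => mem_sInter.1 hp _ ⟨j, hj, rfl⟩)

/-- With a countable base, Cauchy sequences suffice. The limit realizes the conditions "`Q`-close to
`u m` for all `m ≥ N Q`", which have countably many parameters and are finitely satisfied by late
terms of the sequence. -/
theorem completeSpace_of_posSaturated (hU : PosSaturated L F S U (Order.succ ℵ₀))
    [(𝓤 U).IsCountablyGenerated] : CompleteSpace U := by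
  refine UniformSpace.complete_of_cauchySeq_tendsto fun u hu => ?_
  rw [cauchySeq_iff] at hu
  let J := {Q : Set (Fin 2 → U) // CDef L F S Q ∧ {p : U × U | ![p.1, p.2] ∈ Q} ∈ 𝓤 U}
  choose N hN using fun j : J => hu _ j.2.2
  let f : ∀ j : {j : J × ℕ // N j.1 ≤ j.2}, Fin 2 → ℕ ⊕ Fin 1 := fun j => ![.inl j.1.2, .inr 0]
  have hf : ∀ j (z : Fin 1 → U), Sum.elim u z ∘ f j = ![u j.1.2, z 0] := by
    intro j z
    funext i; fin_cases i <;> rfl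
  obtain ⟨z, hz⟩ := hU.exists_forall_mem u
    (fun j : {j : J × ℕ // N j.1 ≤ j.2} => j.1.1.2.1.comp (f j)) (by
    intro t ht
    obtain ⟨m, hm⟩ := (ht.image fun j => N j.1.1).bddAbove
    refine ⟨fun _ => u m, fun j hj => ?_⟩
    change Sum.elim u _ ∘ f j ∈ j.1.1.1
    rw [hf]
    exact hN j.1.1 _ j.2 _ (hm ⟨j, hj, rfl⟩))
  refine ⟨z 0, Uniform.tendsto_nhds_left.2 fun V hV => ?_⟩
  obtain ⟨Q, hQ, hQ𝓤, hQV⟩ := exists_cdef_two_subset L F S hV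
  refine Filter.mem_map.2 (Filter.mem_atTop_sets.2 ⟨N ⟨Q, hQ, hQ𝓤⟩, fun m hm => hQV _ _ ?_⟩)
  rw [← hf ⟨(⟨Q, hQ, hQ𝓤⟩, m), hm⟩]
  exact hz ⟨(⟨Q, hQ, hQ𝓤⟩, m), hm⟩

end Uniform

/-! ### The Tarski–Vaught test and c-models. -/

variable (L F S) in
/-- The Tarski–Vaught test for open conditions. -/
def TarskiVaught (A : Set U) : Prop :=
  ∀ (n : ℕ) (P : Set (Fin (n + 1) → U)), CDef L F S P → ∀ a : Fin n → U, (∀ i, a i ∈ A) →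
    ∀ b : U, Fin.snoc (α := fun _ => U) a b ∉ P → ∃ b ∈ A, Fin.snoc (α := fun _ => U) a b ∉ P

omit [CompactSpace S] [T2Space S] in
theorem TarskiVaught.exists_tuple {A : Set U} (hA : TarskiVaught L F S A) {n k : ℕ}
    {P : Set (Fin n ⊕ Fin k → U)} (hP : CDef L F S P) {a : Fin n → U} (ha : ∀ i, a i ∈ A)
    {b : Fin k → U} (hb : Sum.elim a b ∉ P) :
    ∃ b : Fin k → U, (∀ i, b i ∈ A) ∧ Sum.elim a b ∉ P := by
  induction k with
  | zero => exact ⟨b, fun i => i.elim0, hb⟩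
  | succ k ih =>
    let f : Fin n ⊕ Fin (k + 1) → (Fin n ⊕ Fin k) ⊕ Fin 1 :=
      Sum.elim (fun i => .inl (.inl i)) (Fin.snoc (α := fun _ => (Fin n ⊕ Fin k) ⊕ Fin 1)
        (fun j => .inl (.inr j)) (.inr 0))
    have hf : ∀ (a : Fin n → U) (b : Fin k → U) (z : Fin 1 → U),
        Sum.elim (Sum.elim a b) z ∘ f = Sum.elim a (Fin.snoc (α := fun _ => U) b (z 0)) := by
      intro a b z
      funext i
      rcases i with i | i
      · rfl
      · refine Fin.lastCases ?_ (fun i => ?_) i <;> simp [f]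
    -- Choose the first `k` coordinates in `A` so that the last one can still be found in `U`; the
    -- test itself then brings the last one into `A`.
    obtain ⟨b₀, hb₀, h⟩ := ih (hP.comp f).forall_right (b := Fin.init b) (by
      intro h
      apply hb
      rw [← Fin.snoc_init_self b, ← hf a (Fin.init b) fun _ => b (Fin.last k)]
      exact h fun _ => b (Fin.last k))
    obtain ⟨z, hz⟩ := not_forall.1 h
    change ¬ Sum.elim (Sum.elim a b₀) z ∘ f ∈ P at hz
    rw [hf] at hz
    have hg : ∀ u : U, Fin.snoc (α := fun _ => U) (Fin.append a b₀) u ∘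
        (finSumFinEquiv : Fin n ⊕ Fin (k + 1) ≃ Fin (n + (k + 1))) =
          Sum.elim a (Fin.snoc (α := fun _ => U) b₀ u) := by
      intro u
      have := Fin.append_snoc a b₀ u
      funext i
      rcases i with i | i
      · simp [← this]
      · simp [← this]
    obtain ⟨u, hu, hu'⟩ := hA (n + k) _ (hP.comp finSumFinEquiv) (Fin.append a b₀)
      (fun i => Fin.addCases (fun i => by simpa using ha i) (fun i => by simpa using hb₀ i) i)
      (z 0) (by change ¬ _ ∘ _ ∈ P; rw [hg]; exact hz)
    change ¬ _ ∘ _ ∈ P at hu'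
    rw [hg] at hu'
    refine ⟨_, fun i => ?_, hu'⟩
    refine Fin.lastCases ?_ (fun i => ?_) i
    · simpa using hu
    · simpa using hb₀ i

omit [UniformSpace S] [CompactSpace S] [T2Space S] [StandardStructure F S U] in
theorem coe_snoc {M : L.Substructure U} {n : ℕ} (x : Fin n → M) (b : M) :
    (fun i => ((Fin.snoc (α := fun _ => M) x b i : M) : U)) =
      Fin.snoc (α := fun _ => U) (fun i => (x i : U)) (b : U) := by
  funext i
  refine Fin.lastCases ?_ (fun i => ?_) i <;> simp

/-- If `∀ φ'` fails in `U`, it fails in `M`. The counterexample found in `M` satisfies the strong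
negation `χ` there, and `χ`, unlike `¬ φ'`, is continuous and so transfers to `U`, where it excludes
`φ`. -/
theorem IsCModel.tarskiVaught (hU : PosSaturated L F S U (Order.succ ℵ₀)) {M : L.Substructure U}
    (hM : IsCModel F S M) : TarskiVaught L F S (M : Set U) := by
  intro n P hP a ha b hb
  obtain ⟨φ, hφ, h⟩ := hP.exists_formula
  rw [h] at hb
  obtain ⟨φ', h1, h2⟩ := hU.exists_weakening_not_realize hφ hb
  obtain ⟨χ, hχ, h3⟩ := h1.exists_negation.{uf, ur, uF, us, uU} hφ
  have h4 := mt (hM n φ'.allH (h1.isContinuous hφ) fun i => ⟨a i, ha i⟩) (fun h => h2 (h b))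
  obtain ⟨c, hc⟩ := not_forall.1 h4
  have h5 := hM _ χ hχ _ (not_not.1 (mt (h3 M _ _ _).2 hc))
  refine ⟨c, c.2, fun hP => (h3 U _ _ _).1 ((h _).1 hP) ?_⟩
  rw [coe_snoc] at h5
  exact h5

omit [CompactSpace S] [T2Space S] in
theorem STerm.realize_substructure {M : L.Substructure U} {α β : Type*} (t : STerm L F S α β)
    (v : α → M) (w : β → S) : t.realize (fun a => (v a : U)) w = t.realize v w := by
  induction t with
  | var b => rfl
  | cont f t ih => simp only [realize, ih]
  | app g r t ih =>
    have : ∀ i, (r i).realize (fun a => (v a : U)) = ((r i).realize v : M) := fun i =>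
      FirstOrder.Language.HomClass.realize_term M.subtype
    simp only [realize, ih, this]
    rfl

omit [CompactSpace S] [T2Space S] in
theorem PosFormula.IsContinuous.cdef_realize {n m : ℕ} {φ : PosFormula L F S Empty n m}
    (hφ : φ.IsContinuous) (η : Fin m → S) :
    CDef L F S {v : Fin n → U | φ.Realize U Empty.elim v η} := by
  refine (hφ.cdef (U := U) (Sum.elim Empty.elim Term.var) η).congr fun v => ?_
  simp only [mem_ofPred_eq]
  rw [Subsingleton.elim (fun a => _ : Empty → U) Empty.elim]
  rfl

omit [CompactSpace S] [T2Space S] in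
theorem TarskiVaught.isCModel {M : L.Substructure U}
    (hM : TarskiVaught L F S (M : Set U)) : IsCModel F S M := by
  suffices h : ∀ {n m : ℕ} (φ : PosFormula L F S Empty n m), φ.IsContinuous →
      ∀ (x : Fin n → M) (η : Fin m → S), φ.Realize M Empty.elim x η →
        φ.Realize U Empty.elim (fun i => (x i : U)) η from
    fun n φ hφ a h' => h φ hφ a _ h'
  intro n m φ hφ x η h
  induction φ with
  | home => exact hφ.elim
  | mem C t =>
    simp only [PosFormula.Realize] at h ⊢
    convert h using 2
    rename_i i
    rw [← STerm.realize_substructure]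
    congr 1
    funext a
    rcases a with a | a
    · exact a.elim
    · rfl
  | and φ ψ ih ih' => exact ⟨ih hφ.1 x η h.1, ih' hφ.2 x η h.2⟩
  | or φ ψ ih ih' => exact h.imp (ih hφ.1 x η) (ih' hφ.2 x η)
  | allH φ ih =>
    by_contra hc
    obtain ⟨b, hb⟩ := not_forall.1 hc
    obtain ⟨c, hc, hc'⟩ := hM _ _ (PosFormula.IsContinuous.cdef_realize (φ := φ) hφ η)
      (fun i => (x i : U)) (fun i => (x i).2) b hb
    have := ih hφ _ _ (h ⟨c, hc⟩)
    rw [coe_snoc] at this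
    exact hc' this
  | exH φ ih =>
    obtain ⟨b, hb⟩ := h
    have := ih hφ _ _ hb
    rw [coe_snoc] at this
    exact ⟨b, this⟩
  | allS φ ih => exact fun s => ih hφ _ _ (h s)
  | exS φ ih => exact h.imp fun s hs => ih hφ _ _ hs

/-- Move `a` slightly to a tuple `x` from `A`, for which `∀ φ'` still fails. A counterexample in `A`
for `φ'` at `x` is one for `φ` at `a`, since `φ` at `a` implies `φ'` at `x` uniformly in the last
coordinate. -/
theorem TarskiVaught.closure [UniformSpace U] [CompatibleUniformity L F S U]
    (hU : PosSaturated L F S U (Order.succ ℵ₀)) {A : Set U}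
    (hA : TarskiVaught L F S A) : TarskiVaught L F S (closure A) := by
  intro n P hP a ha b hb
  obtain ⟨φ, hφ, h⟩ := hP.exists_formula
  rw [h] at hb
  obtain ⟨φ', h1, h2⟩ := hU.exists_weakening_not_realize hφ hb
  have hφ' := h1.isContinuous hφ
  have h3 := mem_nhds_left a (snoc_eventually (h1.eventually_realize (U := U) hφ))
  have hcl : IsClosed {v : Fin n → U | φ'.allH.Holds U v} :=
    (PosFormula.IsContinuous.cdef_holds (φ := φ'.allH) hφ').isClosed hU
  have h4 : ∀ᶠ x in 𝓝 a, ¬ φ'.allH.Holds U x :=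
    hcl.isOpen_compl.mem_nhds fun h => h2 (h b)
  have ha' : a ∈ _root_.closure (Set.univ.pi fun _ => A) := by
    rw [closure_pi_set]
    exact fun i _ => ha i
  obtain ⟨x, hxA, hx3, hx4⟩ :=
    ((mem_closure_iff_frequently.1 ha').and_eventually (h4.and h3)).exists
  obtain ⟨c, hc⟩ := not_forall.1 hx3
  obtain ⟨c, hcA, hc⟩ := hA n _ (PosFormula.IsContinuous.cdef_holds hφ') x
    (fun i => hxA i (mem_univ i)) c hc
  exact ⟨c, subset_closure hcA, fun hP => hc (hx4 c _ ((h _).1 hP))⟩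

end Saturated

/-! ### Back and forth with approximations. -/

section BackAndForth

variable {L : FirstOrder.Language.{uf, ur}} {F : ℕ → ℕ → Type uF} {S : Type us}
  [UniformSpace S] [CompactSpace S] [T2Space S] {U : Type uU} [L.Structure U]
  [StandardStructure F S U]

variable (L F S) in
/-- Two tuples have the same continuous type. -/
def TypeEq {ι : Type*} (a b : ι → U) : Prop :=
  ∀ P : Set (ι → U), CDef L F S P → a ∈ P → b ∈ P

omit [CompactSpace S] [T2Space S] in
theorem TypeEq.comp {ι ι' : Type*} {a b : ι → U} (h : TypeEq L F S a b) (f : ι' → ι) :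
    TypeEq L F S (a ∘ f) (b ∘ f) :=
  fun _ hP ha => h _ (hP.comp f) ha

/-- Not automatic, as definable sets have no definable complements; regularity replaces them. -/
theorem TypeEq.symm (hU : PosSaturated L F S U (Order.succ ℵ₀)) {ι : Type*} [Countable ι]
    {a b : ι → U} (h : TypeEq L F S a b) : TypeEq L F S b a := by
  intro P hP hb
  by_contra ha
  obtain ⟨Q, R, hQ, -, hPQ, hQR, haR⟩ := hP.exists_regular hU ha
  exact hPQ hb (h Q hQ (not_not.1 fun h => haR (hQR h)))

omit [CompactSpace S] [T2Space S] in
-- A finite part of the type of `(a, c)`, with `c` quantified out, belongs to the type of `a` and so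
-- holds of `b`; saturation does the rest.
theorem TypeEq.exists_extension (hU : PosSaturated L F S U (Order.succ ℵ₀)) {ι : Type*}
    [Countable ι] {a b : ι → U} (h : TypeEq L F S a b) {k : ℕ} (c : Fin k → U) :
    ∃ d : Fin k → U, TypeEq L F S (Sum.elim a c) (Sum.elim b d) := by
  obtain ⟨d, hd⟩ := hU.exists_forall_mem b
    (fun P : {P : Set (ι ⊕ Fin k → U) // CDef L F S P ∧ Sum.elim a c ∈ P} => P.2.1) (by
      intro t ht
      obtain ⟨z, hz⟩ := h _ (CDef.biInter (fun P : {P : Set (ι ⊕ Fin k → U) //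
        CDef L F S P ∧ Sum.elim a c ∈ P} => P.2.1) ht).exists_right
          ⟨c, mem_iInter₂.2 fun P _ => P.2.2⟩
      exact ⟨z, fun P hP => mem_iInter₂.1 hz P hP⟩)
  exact ⟨d, fun P hP h => hd ⟨P, hP, h⟩⟩

variable (L F S) in
/-- `b` is `G`-close to a tuple of the same type as `a`. -/
def TypeClose {ι : Type*} (G : Set (ι ⊕ ι → U)) (a b : ι → U) : Prop :=
  ∃ b' : ι → U, TypeEq L F S a b' ∧ Sum.elim b' b ∉ G

/-- Transport the close pair `(b', b)` along the equality of types of `b'` and `a`: it becomes a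
close pair `(a, d)` with `d` of the type of `b`. -/
theorem TypeClose.symm (hU : PosSaturated L F S U (Order.succ ℵ₀)) {k : ℕ}
    {G : Set (Fin k ⊕ Fin k → U)} (hG : CDef L F S G)
    (hsymm : ∀ x y : Fin k → U, Sum.elim x y ∉ G → Sum.elim y x ∉ G) {a b : Fin k → U}
    (h : TypeClose L F S G a b) : TypeClose L F S G b a := by
  obtain ⟨b', hb', hbG⟩ := h
  obtain ⟨d, hd⟩ := (hb'.symm hU).exists_extension hU b
  exact ⟨d, hd.comp .inr, hsymm _ _ fun h => hbG (hd.symm hU _ hG h)⟩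

section Uniform

variable [UniformSpace U] [CompatibleUniformity L F S U]

/-- Approximate isolation applied to the complete continuous type of `x`. The isolating open set
contains one realization, hence every realization, in particular `x`. -/
theorem exists_cdef_isolating
    (hiso : ∀ (n : ℕ) (p : Set (PosFormula L F S Empty n 0)),
      (∀ φ ∈ p, φ.IsContinuous) → Consistent U p → ApproxCIsolated U p)
    {n : ℕ} (x : Fin n → U) {V : Set ((Fin n → U) × (Fin n → U))} (hV : V ∈ 𝓤 (Fin n → U)) :
    ∃ O : Set (Fin n → U), CDef L F S O ∧ x ∉ O ∧
      ∀ y ∉ O, ∃ x', TypeEq L F S x x' ∧ (x', y) ∈ V := by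
  obtain ⟨ε, hε⟩ := exists_entourage_rel L F S hV
  have htype : ∀ u : Fin n → U,
      (∀ φ ∈ {φ : PosFormula L F S Empty n 0 | φ.IsContinuous ∧ φ.Holds U x}, φ.Holds U u) →
        TypeEq L F S x u := by
    intro u hu P hP hx
    obtain ⟨φ, hφ, h⟩ := hP.exists_formula
    exact (h u).2 (hu φ ⟨hφ, (h x).1 hx⟩)
  obtain ⟨φ, hφ, ⟨u, hu, hup⟩, h⟩ := hiso n {φ | φ.IsContinuous ∧ φ.Holds U x}
    (fun φ h => h.1) ⟨x, fun φ h => h.2⟩ ε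
  refine ⟨_, hφ.cdef_holds, fun hx => hu (hup φ ⟨hφ, hx⟩), fun y hy => ?_⟩
  obtain ⟨x', hx', hx'p⟩ := h y hy
  exact ⟨x', htype x' hx'p, hε _ _ hx'⟩

/-- The one step of the back-and-forth. The tuple `(b', d)` realizes the type of `(a, m)` and starts
at distance `G` from `b`; both the isolating condition and closeness to `b` are open, so the
Tarski–Vaught test in `B` provides `c`. The old part `b` is only approximated by `c`, not extended.
-/
theorem TypeClose.exists_extension (hU : PosSaturated L F S U (Order.succ ℵ₀))
    (hiso : ∀ (n : ℕ) (p : Set (PosFormula L F S Empty n 0)),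
      (∀ φ ∈ p, φ.IsContinuous) → Consistent U p → ApproxCIsolated U p)
    {B : Set U} (hB : TarskiVaught L F S B) {k : ℕ} {G : Set (Fin k ⊕ Fin k → U)}
    (hG : CDef L F S G) {G' : Set (Fin (k + 1) ⊕ Fin (k + 1) → U)}
    (hG' : ∀ᶠ p in 𝓤 (Fin (k + 1) → U), Sum.elim p.1 p.2 ∉ G') {a b : Fin k → U}
    (hb : ∀ i, b i ∈ B) (h : TypeClose L F S G a b) (m : U) :
    ∃ c : Fin (k + 1) → U, (∀ i, c i ∈ B) ∧ Sum.elim (c ∘ Fin.castSucc) b ∉ G ∧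
      TypeClose L F S G' (Fin.snoc (α := fun _ => U) a m) c := by
  obtain ⟨b', hb', hbG⟩ := h
  obtain ⟨d, hd⟩ := hb'.exists_extension hU (fun _ : Fin 1 => m)
  let f : Fin (k + 1) → Fin k ⊕ Fin 1 := Fin.snoc (α := fun _ => Fin k ⊕ Fin 1) .inl (.inr 0)
  have hf : ∀ (x : Fin k → U) (z : Fin 1 → U),
      Sum.elim x z ∘ f = Fin.snoc (α := fun _ => U) x (z 0) := by
    intro x z
    funext i
    refine Fin.lastCases ?_ (fun i => ?_) i <;> simp [f]
  have hd' := hd.comp f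
  rw [hf, hf] at hd'
  obtain ⟨O, hO, haO, hOG⟩ := exists_cdef_isolating hiso
    (Fin.snoc (α := fun _ => U) a m) hG'
  have hdO : Fin.snoc (α := fun _ => U) b' (d 0) ∉ O := fun h => haO (hd'.symm hU _ hO h)
  have hP : CDef L F S ({v : Fin k ⊕ Fin (k + 1) → U | v ∘ Sum.inr ∈ O} ∪
      {v | v ∘ Sum.elim (Sum.inr ∘ Fin.castSucc) Sum.inl ∈ G}) := (hO.comp _).union (hG.comp _)
  have hg : ∀ (c : Fin (k + 1) → U), Sum.elim b c ∘ Sum.elim (Sum.inr ∘ Fin.castSucc) Sum.inl =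
      Sum.elim (c ∘ Fin.castSucc) b := by
    intro c
    funext i
    rcases i with i | i <;> rfl
  obtain ⟨c, hcB, hc⟩ := hB.exists_tuple hP hb (b := Fin.snoc (α := fun _ => U) b' (d 0)) (by
    rintro (h | h)
    · exact hdO h
    · change _ ∘ _ ∈ G at h
      rw [hg] at h
      refine hbG (mem_of_eq_of_mem ?_ h)
      funext i
      rcases i with i | i <;> simp)
  obtain ⟨x', hx', hxG⟩ := hOG c fun h => hc (.inl h)
  refine ⟨c, hcB, fun h => hc (.inr ?_), x', hx', hxG⟩
  change _ ∘ _ ∈ G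
  rwa [hg]

end Uniform

/-! ### Limits of the approximations. -/

section Metric

variable [PseudoMetricSpace U] [CompatibleUniformity L F S U]

variable (L F S U) in
theorem exists_cdef_dist_lt (k : ℕ) {r : ℝ} (hr : 0 < r) :
    ∃ G : Set (Fin k ⊕ Fin k → U), CDef L F S G ∧
      (∀ᶠ p in 𝓤 (Fin k → U), Sum.elim p.1 p.2 ∉ G) ∧
      (∀ x y : Fin k → U, Sum.elim x y ∉ G → Sum.elim y x ∉ G) ∧
      ∀ x y : Fin k → U, Sum.elim x y ∉ G → ∀ i, dist (x i) (y i) < r := by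
  obtain ⟨G, hG, h1, h2⟩ := exists_cdef_compl_subset L F S (n := k)
    (V := {p : (Fin k → U) × (Fin k → U) | ∀ i, dist (p.1 i) (p.2 i) < r})
      (pi_eventually (Metric.dist_mem_uniformity hr))
  have hswap : ∀ x y : Fin k → U, Sum.elim x y ∘ Sum.swap = Sum.elim y x := by
    intro x y
    funext i
    rcases i with i | i <;> rfl
  have hmem : ∀ x y : Fin k → U, Sum.elim x y ∈ G ∪ {v | v ∘ Sum.swap ∈ G} ↔
      Sum.elim x y ∈ G ∨ Sum.elim y x ∈ G := by
    intro x y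
    rw [mem_union]
    change _ ∨ _ ∘ _ ∈ G ↔ _
    rw [hswap]
  refine ⟨G ∪ {v | v ∘ Sum.swap ∈ G}, hG.union (hG.comp _), ?_, fun x y => ?_,
    fun x y h => h2 x y fun h' => h (.inl h')⟩
  · filter_upwards [h1, tendsto_swap_uniformity h1] with p hp hp'
    rw [hmem]
    exact not_or.2 ⟨hp, hp'⟩
  · rw [hmem, hmem]
    exact mt Or.symm

/-- The sequence of finite approximations built by going back and forth. -/
theorem exists_approximations [Nonempty U] (hU : PosSaturated L F S U (Order.succ ℵ₀))
    (hiso : ∀ (n : ℕ) (p : Set (PosFormula L F S Empty n 0)),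
      (∀ φ ∈ p, φ.IsContinuous) → Consistent U p → ApproxCIsolated U p)
    {A B : Set U} (hA : TarskiVaught L F S A) (hB : TarskiVaught L F S B)
    {e e' : ℕ → U} (he : ∀ j, e j ∈ A) (he' : ∀ j, e' j ∈ B) (G : ∀ k, Set (Fin k ⊕ Fin k → U))
    (hG : ∀ k, CDef L F S (G k)) (hG𝓤 : ∀ k, ∀ᶠ p in 𝓤 (Fin k → U), Sum.elim p.1 p.2 ∉ G k)
    (hGs : ∀ k (x y : Fin k → U), Sum.elim x y ∉ G k → Sum.elim y x ∉ G k)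
    (hGd : ∀ k (x y : Fin k → U), Sum.elim x y ∉ G k → ∀ i, dist (x i) (y i) < (1 / 2) ^ k) :
    ∃ α β : ℕ → ℕ → U, (∀ s i, i < s → α s i ∈ A) ∧ (∀ s i, i < s → β s i ∈ B) ∧
      (∀ s, TypeClose L F S (G s) (fun i => α s i) (fun i => β s i)) ∧
      (∀ s i, i < s → dist (α s i) (α (s + 1) i) ≤ (1 / 2) ^ s) ∧
      (∀ s i, i < s → dist (β s i) (β (s + 1) i) ≤ (1 / 2) ^ s) ∧
      (∀ j, α (2 * j + 1) (2 * j) = e j) ∧ (∀ j, β (2 * j + 1 + 1) (2 * j + 1) = e' j) := by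
  -- States of the construction. Even stages append an element of `A` and move the `B`-side; odd
  -- stages do the reverse, using symmetry of closeness.
  let T : ℕ → Type uU := fun s => {p : (Fin s → U) × (Fin s → U) // (∀ i, p.1 i ∈ A) ∧
    (∀ i, p.2 i ∈ B) ∧ TypeClose L F S (G s) p.1 p.2}
  have hnext : ∀ s (p : T s), ∃ q : T (s + 1),
      (∀ i, dist (p.1.1 i) (q.1.1 (Fin.castSucc i)) ≤ (1 / 2) ^ s) ∧
      (∀ i, dist (p.1.2 i) (q.1.2 (Fin.castSucc i)) ≤ (1 / 2) ^ s) ∧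
      (Even s → q.1.1 (Fin.last s) = e (s / 2)) ∧
      (¬ Even s → q.1.2 (Fin.last s) = e' (s / 2)) := by
    rintro s ⟨⟨a, b⟩, ha, hb, hab⟩
    by_cases hs : Even s
    · obtain ⟨c, hc, hcG, h⟩ := hab.exists_extension hU hiso hB (hG s) (hG𝓤 (s + 1)) hb (e (s / 2))
      refine ⟨⟨(Fin.snoc (α := fun _ => U) a (e (s / 2)), c), fun i => ?_, hc, h⟩,
        fun i => by simp, fun i => ?_, fun _ => by simp, fun h => (h hs).elim⟩
      · refine Fin.lastCases ?_ (fun i => ?_) i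
        · simpa using he _
        · simpa using ha i
      · rw [dist_comm]
        exact (hGd s _ _ hcG i).le
    · obtain ⟨c, hc, hcG, h⟩ := (hab.symm hU (hG s) (hGs s)).exists_extension hU hiso hA (hG s)
        (hG𝓤 (s + 1)) ha (e' (s / 2))
      refine ⟨⟨(c, Fin.snoc (α := fun _ => U) b (e' (s / 2))), hc, fun i => ?_,
        h.symm hU (hG _) (hGs _)⟩, fun i => ?_, fun i => by simp, fun h => (hs h).elim,
          fun _ => by simp⟩
      · refine Fin.lastCases ?_ (fun i => ?_) i
        · simpa using he' _
        · simpa using hb i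
      · rw [dist_comm]
        exact (hGd s _ _ hcG i).le
  choose nxt hnxt using hnext
  let t₀ : T 0 := ⟨(Fin.elim0, Fin.elim0), fun i => i.elim0, fun i => i.elim0, Fin.elim0,
    fun P _ h => h, refl_mem_uniformity (hG𝓤 0)⟩
  let t : ∀ s, T s := fun s => Nat.rec t₀ nxt s
  have ht : ∀ s, t (s + 1) = nxt s (t s) := fun s => rfl
  let u : U := Classical.arbitrary U
  -- The value `u` at indices `i ≥ s` is padding and is never used.
  let α : ℕ → ℕ → U := fun s i => if h : i < s then (t s).1.1 ⟨i, h⟩ else u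
  let β : ℕ → ℕ → U := fun s i => if h : i < s then (t s).1.2 ⟨i, h⟩ else u
  have hα : ∀ s i (h : i < s), α s i = (t s).1.1 ⟨i, h⟩ := fun s i h => dif_pos h
  have hβ : ∀ s i (h : i < s), β s i = (t s).1.2 ⟨i, h⟩ := fun s i h => dif_pos h
  refine ⟨α, β, fun s i h => ?_, fun s i h => ?_, fun s => ?_, fun s i h => ?_, fun s i h => ?_,
    fun j => ?_, fun j => ?_⟩
  · rw [hα s i h]; exact (t s).2.1 _
  · rw [hβ s i h]; exact (t s).2.2.1 _
  · have h1 : (fun i : Fin s => α s i) = (t s).1.1 := funext fun i => hα s i i.2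
    have h2 : (fun i : Fin s => β s i) = (t s).1.2 := funext fun i => hβ s i i.2
    rw [h1, h2]
    exact (t s).2.2.2
  · rw [hα s i h, hα (s + 1) i (by omega)]
    exact (hnxt s (t s)).1 ⟨i, h⟩
  · rw [hβ s i h, hβ (s + 1) i (by omega)]
    exact (hnxt s (t s)).2.1 ⟨i, h⟩
  · rw [hα _ _ (Nat.lt_succ_self _)]
    have := (hnxt (2 * j) (t (2 * j))).2.2.1 (even_two_mul j)
    rwa [Nat.mul_div_cancel_left j two_pos] at this
  · rw [hβ _ _ (Nat.lt_succ_self _)]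
    have := (hnxt (2 * j + 1) (t (2 * j + 1))).2.2.2 (by simp)
    rwa [show (2 * j + 1) / 2 = j by omega] at this

/-- The tail of the geometric series from stage `s` sums to `2 · 2⁻ˢ`. -/
theorem exists_limits {X : Type*} [PseudoMetricSpace X] [CompleteSpace X] {α : ℕ → ℕ → X}
    (h : ∀ s i, i < s → dist (α s i) (α (s + 1) i) ≤ (1 / 2) ^ s) :
    ∃ c : ℕ → X, ∀ i s, i < s → dist (α s i) (c i) ≤ 2 * (1 / 2) ^ s := by
  have key : ∀ i, ∃ c, ∀ s, i < s → dist (α s i) c ≤ 2 * (1 / 2) ^ s := by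
    intro i
    have hu : ∀ k, dist (α (i + 1 + k) i) (α (i + 1 + (k + 1)) i) ≤
        (2 * (1 / 2) ^ (i + 1)) / 2 / 2 ^ k := by
      intro k
      refine (h (i + 1 + k) i (by omega)).trans_eq ?_
      rw [pow_add (1 / 2 : ℝ) (i + 1) k, one_div_pow (2 : ℝ) k]
      ring
    obtain ⟨c, hc⟩ := cauchySeq_tendsto_of_complete (cauchySeq_of_le_geometric_two hu)
    refine ⟨c, fun s hs => ?_⟩
    obtain ⟨k, rfl⟩ := Nat.exists_eq_add_of_le (Nat.succ_le_of_lt hs)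
    refine (dist_le_of_le_geometric_two_of_tendsto hu hc k).trans_eq ?_
    rw [Nat.succ_eq_add_one, pow_add (1 / 2 : ℝ) (i + 1) k, one_div_pow (2 : ℝ) k]
    ring
  choose c hc using key
  exact ⟨c, hc⟩

theorem tendsto_of_dist_le_pow {X : Type*} [PseudoMetricSpace X] {α : ℕ → ℕ → X} {c : ℕ → X}
    (h : ∀ i s, i < s → dist (α s i) (c i) ≤ 2 * (1 / 2) ^ s) (i : ℕ) :
    Filter.Tendsto (fun s => α s i) Filter.atTop (𝓝 (c i)) := by
  rw [tendsto_iff_dist_tendsto_zero]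
  refine squeeze_zero' (Filter.Eventually.of_forall fun s => dist_nonneg)
    ((Filter.eventually_gt_atTop i).mono fun s hs => h i s hs) ?_
  simpa using (tendsto_pow_atTop_nhds_zero_of_lt_one (r := (1 / 2 : ℝ)) (by norm_num)
    (by norm_num)).const_mul 2

/-- Regularity leaves room for the approximation. At a late stage `α` lies in the open set `Qᶜ ⊆ R`,
so the tuple `b'` of the same type lies in `R`; but `b'` is close to `β`, which is close to the
limit `d`, and `d` lies outside the closed set `R`. -/
theorem mem_of_typeClose (hU : PosSaturated L F S U (Order.succ ℵ₀))
    {G : ∀ k, Set (Fin k ⊕ Fin k → U)}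
    (hGd : ∀ k (x y : Fin k → U), Sum.elim x y ∉ G k → ∀ i, dist (x i) (y i) < (1 / 2) ^ k)
    {α β : ℕ → ℕ → U} {c d : ℕ → U}
    (hα : ∀ i, Filter.Tendsto (fun s => α s i) Filter.atTop (𝓝 (c i)))
    (hβ : ∀ i, Filter.Tendsto (fun s => β s i) Filter.atTop (𝓝 (d i)))
    (h : ∀ s, TypeClose L F S (G s) (fun i => α s i) (fun i => β s i)) {k : ℕ} (f : Fin k → ℕ)
    {P : Set (Fin k → U)} (hP : CDef L F S P) (hc : c ∘ f ∈ P) : d ∘ f ∈ P := by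
  by_contra hd
  obtain ⟨Q, R, hQ, hR, hPQ, hQR, hdR⟩ := hP.exists_regular hU hd
  obtain ⟨δ, hδ, hball⟩ := Metric.mem_nhds_iff.1 ((hR.isClosed hU).isOpen_compl.mem_nhds hdR)
  have h1 : ∀ᶠ s in Filter.atTop, (fun j => α s (f j)) ∈ Qᶜ :=
    (tendsto_pi_nhds.2 fun j => hα (f j)).eventually
      ((hQ.isClosed hU).isOpen_compl.mem_nhds (hPQ hc))
  have h2 : ∀ᶠ s in Filter.atTop, dist (fun j => β s (f j)) (d ∘ f) < δ / 2 :=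
    (tendsto_pi_nhds.2 fun j => hβ (f j)).eventually (Metric.ball_mem_nhds _ (half_pos hδ))
  have h3 : ∀ᶠ s : ℕ in Filter.atTop, (1 / 2 : ℝ) ^ s < δ / 2 :=
    (tendsto_pow_atTop_nhds_zero_of_lt_one (by norm_num) (by norm_num)).eventually
      (gt_mem_nhds (half_pos hδ))
  have h4 : ∀ᶠ s in Filter.atTop, ∀ j, f j < s :=
    Filter.eventually_all.2 fun j => Filter.eventually_gt_atTop (f j)
  obtain ⟨s, h1, h2, h3, h4⟩ := (h1.and (h2.and (h3.and h4))).exists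
  obtain ⟨b', hb', hbG⟩ := h s
  let g : Fin k → Fin s := fun j => ⟨f j, h4 j⟩
  have hR' : b' ∘ g ∈ R := hb'.comp g _ hR (hQR h1)
  refine hball (Metric.mem_ball.2 ?_) hR'
  have h5 : dist (b' ∘ g) (fun j => β s (f j)) < δ / 2 :=
    (dist_pi_lt_iff (half_pos hδ)).2 fun j => (hGd s _ _ hbG (g j)).trans h3
  linarith [dist_triangle (b' ∘ g) (fun j => β s (f j)) (d ∘ f)]

/-- The graph of the closure of the correspondence `c i ↦ d i`. -/
def LimitRel {X : Type*} [PseudoMetricSpace X] (c d : ℕ → X) (x y : X) : Prop :=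
  ∀ δ > 0, ∃ i, dist (c i) x < δ ∧ dist (d i) y < δ

theorem limitRel_preservesAtomic (hU : PosSaturated L F S U (Order.succ ℵ₀)) {c d : ℕ → U}
    (h : ∀ (k : ℕ) (f : Fin k → ℕ) (P : Set (Fin k → U)), CDef L F S P → c ∘ f ∈ P → d ∘ f ∈ P) :
    PreservesAtomic L F S (LimitRel c d) := by
  intro n k C t a b hab ha
  have hP : CDef L F S {v : Fin n → U | (PosFormula.mem C t).Holds U v} :=
    PosFormula.IsContinuous.cdef_holds (by simp only [PosFormula.IsContinuous])
  by_contra hb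
  obtain ⟨Q, R, hQ, hR, hPQ, hQR, hbR⟩ := hP.exists_regular hU hb
  obtain ⟨δ, hδ, h1⟩ := Metric.mem_nhds_iff.1 ((hR.isClosed hU).isOpen_compl.mem_nhds hbR)
  obtain ⟨δ', hδ', h2⟩ := Metric.mem_nhds_iff.1 ((hQ.isClosed hU).isOpen_compl.mem_nhds (hPQ ha))
  choose f hf hf' using fun j => hab j (min δ δ') (lt_min hδ hδ')
  have h3 : c ∘ f ∈ Qᶜ := h2 ((dist_pi_lt_iff hδ').2 fun j => (hf j).trans_le (min_le_right _ _))
  have h4 : d ∘ f ∈ Rᶜ := h1 ((dist_pi_lt_iff hδ).2 fun j => (hf' j).trans_le (min_le_left _ _))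
  exact h4 (h _ f R hR (hQR h3))

/-- If `c ∘ i` is Cauchy then so is `d ∘ i`, because definable entourages carry over from `c` to
`d`; completeness provides the partner of the limit. -/
theorem domain_limitRel [CompleteSpace U] {c d : ℕ → U}
    (h : ∀ (k : ℕ) (f : Fin k → ℕ) (P : Set (Fin k → U)), CDef L F S P → c ∘ f ∈ P → d ∘ f ∈ P) :
    {x | ∃ y, LimitRel c d x y} = closure (range c) := by
  ext x
  constructor
  · rintro ⟨y, hy⟩
    refine Metric.mem_closure_iff.2 fun δ hδ => ?_
    obtain ⟨i, hi, -⟩ := hy δ hδ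
    exact ⟨c i, ⟨i, rfl⟩, by rwa [dist_comm]⟩
  · intro hx
    obtain ⟨u, hu, hux⟩ := mem_closure_iff_seq_limit.1 hx
    choose i hi using hu
    obtain rfl : c ∘ i = u := funext hi
    have hcauchy : CauchySeq (d ∘ i) := by
      refine cauchySeq_iff.2 fun V hV => ?_
      obtain ⟨Q, hQ, hQ𝓤, hQV⟩ := exists_cdef_two_subset L F S hV
      obtain ⟨N, hN⟩ := cauchySeq_iff.1 hux.cauchySeq _ hQ𝓤
      refine ⟨N, fun m hm l hl => hQV _ _ ?_⟩
      have e : ∀ c : ℕ → U, ![c (i m), c (i l)] = c ∘ ![i m, i l] := by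
        intro c
        funext j
        fin_cases j <;> rfl
      have := hN m hm l hl
      change ![c (i m), c (i l)] ∈ Q at this
      rw [e] at this
      change ![d (i m), d (i l)] ∈ Q
      rw [e]
      exact h _ _ _ hQ this
    obtain ⟨y, hy⟩ := cauchySeq_tendsto_of_complete hcauchy
    refine ⟨y, fun δ hδ => ?_⟩
    obtain ⟨m, hm⟩ := ((hux.eventually (Metric.ball_mem_nhds _ hδ)).and
      (hy.eventually (Metric.ball_mem_nhds _ hδ))).exists
    exact ⟨i m, hm⟩

/-- The element introduced at position `g j` is off by at most `2 · 2^-(g j + 1)` in the limit. As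
each element of `A` is enumerated at arbitrarily late stages, it is a limit of points `c i`. -/
theorem closure_range_limits {X : Type*} [PseudoMetricSpace X] {A : Set X} {α : ℕ → ℕ → X}
    {c e : ℕ → X} (hα : ∀ s i, i < s → α s i ∈ A)
    (hc : ∀ i s, i < s → dist (α s i) (c i) ≤ 2 * (1 / 2) ^ s)
    (he : ∀ x ∈ A, ∀ N : ℕ, ∃ j ≥ N, e j = x) {g : ℕ → ℕ} (hg : ∀ j, j ≤ g j)
    (hαe : ∀ j, α (g j + 1) (g j) = e j) : closure (range c) = closure A := by
  refine subset_antisymm (closure_minimal ?_ isClosed_closure) (closure_minimal ?_ isClosed_closure)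
  · rintro _ ⟨i, rfl⟩
    exact mem_closure_of_tendsto (tendsto_of_dist_le_pow hc i)
      ((Filter.eventually_gt_atTop i).mono fun s hs => hα s i hs)
  · intro x hx
    refine Metric.mem_closure_iff.2 fun δ hδ => ?_
    obtain ⟨N, hN⟩ := exists_pow_lt_of_lt_one hδ (y := (1 / 2 : ℝ)) (by norm_num)
    obtain ⟨j, hj, rfl⟩ := he x hx N
    refine ⟨c (g j), ⟨_, rfl⟩, ?_⟩
    have h1 := hc (g j) (g j + 1) (Nat.lt_succ_self _)
    rw [hαe] at h1
    have h2 : (1 / 2 : ℝ) ^ (g j) ≤ (1 / 2) ^ N :=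
      pow_le_pow_of_le_one (by norm_num) (by norm_num) (hj.trans (hg j))
    rw [pow_succ] at h1
    linarith

theorem cIsomorphic_closure [CompleteSpace U] (hU : PosSaturated L F S U (Order.succ ℵ₀))
    (hiso : ∀ (n : ℕ) (p : Set (PosFormula L F S Empty n 0)),
      (∀ φ ∈ p, φ.IsContinuous) → Consistent U p → ApproxCIsolated U p)
    {A B : Set U} (hA : TarskiVaught L F S A) (hB : TarskiVaught L F S B) (hAc : A.Countable)
    (hBc : B.Countable) : CIsomorphic L F S (closure A) (closure B) := by
  rcases isEmpty_or_nonempty U with hE | ⟨⟨u⟩⟩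
  · exact ⟨fun _ _ => True, fun n k C t a b _ h => by rwa [Subsingleton.elim b a],
      Subsingleton.elim _ _, Subsingleton.elim _ _⟩
  have hne : ∀ {A : Set U}, TarskiVaught L F S A → A.Countable →
      ∃ e : ℕ → U, (∀ j, e j ∈ A) ∧ ∀ x ∈ A, ∀ N : ℕ, ∃ j ≥ N, e j = x := by
    intro A hA hAc
    obtain ⟨b, hb, -⟩ := hA 0 ∅ (CDef.empty L F S) Fin.elim0 (fun i => i.elim0) u (fun h => h)
    obtain ⟨f, rfl⟩ := hAc.exists_eq_range ⟨b, hb⟩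
    -- Unpairing repeats every element infinitely often.
    refine ⟨fun j => f j.unpair.1, fun j => ⟨_, rfl⟩, ?_⟩
    rintro _ ⟨q, rfl⟩ N
    exact ⟨Nat.pair q N, Nat.right_le_pair q N, by simp⟩
  obtain ⟨e, he, heA⟩ := hne hA hAc
  obtain ⟨e', he', heB⟩ := hne hB hBc
  choose G hG hG𝓤 hGs hGd using fun k : ℕ =>
    exists_cdef_dist_lt L F S U k (r := (1 / 2) ^ k) (by positivity)
  have : Nonempty U := ⟨u⟩
  obtain ⟨α, β, hαA, hβB, hαβ, hα, hβ, hαe, hβe⟩ :=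
    exists_approximations hU hiso hA hB he he' G hG hG𝓤 hGs hGd
  obtain ⟨c, hc⟩ := exists_limits hα
  obtain ⟨d, hd⟩ := exists_limits hβ
  have hcd : ∀ (k : ℕ) (f : Fin k → ℕ) (P : Set (Fin k → U)), CDef L F S P →
      c ∘ f ∈ P → d ∘ f ∈ P := fun k f P hP => mem_of_typeClose hU hGd
    (tendsto_of_dist_le_pow hc) (tendsto_of_dist_le_pow hd) hαβ f hP
  have hdc : ∀ (k : ℕ) (f : Fin k → ℕ) (P : Set (Fin k → U)), CDef L F S P →
      d ∘ f ∈ P → c ∘ f ∈ P := fun k f P hP => mem_of_typeClose hU hGd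
    (tendsto_of_dist_le_pow hd) (tendsto_of_dist_le_pow hc)
      (fun s => (hαβ s).symm hU (hG s) (hGs s)) f hP
  refine ⟨LimitRel c d, limitRel_preservesAtomic hU hcd, ?_, ?_⟩
  · rw [domain_limitRel hcd, closure_range_limits hαA hc heA (g := fun j => 2 * j)
      (fun j => by omega) hαe]
  -- The range is the domain of the reversed relation, to which the same lemma applies because the
  -- types also pass from `d` to `c`.
  · rw [← closure_range_limits hβB hd heB (g := fun j => 2 * j + 1) (fun j => by omega) hβe,
      ← domain_limitRel hdc]
    simp only [LimitRel, and_comm]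

end Metric

end BackAndForth

/-! ### Löwenheim–Skolem, c-isomorphisms, and the space of sequences. -/

section Omitting

variable {L : FirstOrder.Language.{uf, ur}} {F : ℕ → ℕ → Type uF} {S : Type us}
  {U : Type uU} [L.Structure U]

open FirstOrder.Language (Term)

/-- The expansion of the function symbols of `L` by a symbol for each element of `H n`. -/
def witnessLanguage (L : FirstOrder.Language.{uf, ur}) (H : ∀ n, Set (Set (Fin (n + 1) → U))) :
    FirstOrder.Language.{max uf uU, 0} :=
  ⟨fun n => L.Functions n ⊕ H n, fun _ => Empty⟩

open Classical in
/-- The new symbols are interpreted by Skolem functions for the complements. -/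
noncomputable instance [Nonempty U] (H : ∀ n, Set (Set (Fin (n + 1) → U))) :
    (witnessLanguage L H).Structure U where
  funMap := Sum.elim (fun f x => FirstOrder.Language.Structure.funMap f x) (fun Q x =>
    if h : ∃ b : U, Fin.snoc (α := fun _ => U) x b ∉ Q.1 then h.choose else Classical.arbitrary U)
  RelMap r := r.elim

section

variable [UniformSpace S] [CompactSpace S] [T2Space S] [StandardStructure F S U]

/-- The downward Löwenheim–Skolem theorem. -/
theorem exists_countable_isCModel [Countable (Σ n, L.Functions n)]
    (hU : PosSaturated L F S U (Order.succ ℵ₀)) (hsep : ContinuousSeparable L F S U) {n : ℕ}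
    (a : Fin n → U) :
    ∃ M : L.Substructure U, Countable M ∧ IsCModel F S M ∧ ∀ i, a i ∈ M := by
  rcases isEmpty_or_nonempty U with hE | hne
  · exact ⟨⊤, inferInstance, TarskiVaught.isCModel fun n P hP a ha b => hE.elim b, fun i => trivial⟩
  obtain ⟨H, hH, hHc, hHd⟩ := hsep.exists_countable_cdef hU
  let L' := witnessLanguage L fun n => H (n + 1)
  have : Countable (Σ n, L'.Functions n) := by
    have : ∀ n, Countable (H (n + 1)) := fun n => (hH (n + 1)).to_subtype
    have : Countable (Σ n, H (n + 1)) := inferInstance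
    let f : (Σ n, L'.Functions n) → (Σ n, L.Functions n) ⊕ (Σ n, H (n + 1)) := fun x =>
      Sum.elim (fun g => .inl ⟨x.1, g⟩) (fun Q => .inr ⟨x.1, Q⟩) x.2
    refine Function.Injective.countable (f := f) ?_
    rintro ⟨n, g | Q⟩ ⟨n', g' | Q'⟩ h
    · cases h; rfl
    · cases h
    · cases h
    · cases h; rfl
  -- Skolem functions for the countable dense family suffice: any definable `P` missing a point lies
  -- in a member `Q` of the family missing it too, and a witness against `Q` is one against `P`.
  let M' := FirstOrder.Language.Substructure.closure L' (range a)
  have hM' : Countable M' := (countable_range a).substructure_closure L'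
  let M : L.Substructure U := ⟨M', fun f x hx => M'.fun_mem (Sum.inl f) x hx⟩
  have hTV : TarskiVaught L F S (M : Set U) := by
    intro n P hP x hx b hb
    obtain ⟨Q, hQ, hPQ, hbQ⟩ := hHd _ P hP _ hb
    have hex : ∃ b : U, Fin.snoc (α := fun _ => U) x b ∉ Q := ⟨b, hbQ⟩
    refine ⟨hex.choose, ?_, fun h => hex.choose_spec (hPQ h)⟩
    have := M'.fun_mem (Sum.inr ⟨Q, hQ⟩) x hx
    have e : FirstOrder.Language.Structure.funMap (L := L') (M := U) (Sum.inr ⟨Q, hQ⟩) x =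
      hex.choose := dif_pos hex
    rw [e] at this
    exact this
  exact ⟨M, hM', hTV.isCModel, fun i => FirstOrder.Language.Substructure.subset_closure ⟨i, rfl⟩⟩

theorem PosFormula.Weakening.trans {S : Type us} [TopologicalSpace S] {α : Type*} {n m : ℕ}
    {φ φ₁ φ₂ : PosFormula L F S α n m} (h : φ.Weakening φ₁) (h' : φ₁.Weakening φ₂) :
    φ.Weakening φ₂ := by
  induction h with
  | home => exact h'
  | mem C C' t h =>
    cases h' with
    | mem _ C'' _ h' => exact .mem _ _ _ (Filter.mem_of_superset h (subset_of_mem_nhdsSet h'))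
  | and _ _ ih ih' => cases h' with | and a b => exact .and (ih a) (ih' b)
  | or _ _ ih ih' => cases h' with | or a b => exact .or (ih a) (ih' b)
  | allH _ ih => cases h' with | allH a => exact .allH (ih a)
  | exH _ ih => cases h' with | exH a => exact .exH (ih a)
  | allS _ ih => cases h' with | allS a => exact .allS (ih a)
  | exS _ ih => cases h' with | exS a => exact .exS (ih a)

/-- Witnesses in `U` must first be moved into `A` or `B` before `R` can match them, and the
existential case pays for this with a weakening. The formula `φ` fixes the shape for the induction
while `φ₁` may grow. -/
theorem PreservesAtomic.realize_of_weakening_of_weakening {A B : Set U}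
    (hA : TarskiVaught L F S A) (hB : TarskiVaught L F S B) {R : U → U → Prop}
    (hR : PreservesAtomic L F S R) (hRA : {a | ∃ b, R a b} = A) (hRB : {b | ∃ a, R a b} = B)
    {n m : ℕ} {φ φ₁ φ₂ : PosFormula L F S Empty n m} (h₁ : φ.Weakening φ₁) (h₂ : φ₁.Weakening φ₂)
    (hφ : φ.IsContinuous) {a b : Fin n → U} (hab : ∀ i, R (a i) (b i)) {η : Fin m → S}
    (ha : φ₁.Realize U Empty.elim a η) : φ₂.Realize U Empty.elim b η := by
  have hsnoc : ∀ {n : ℕ} {a b : Fin n → U}, (∀ i, R (a i) (b i)) → ∀ {x y : U}, R x y →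
      ∀ i, R (Fin.snoc (α := fun _ => U) a x i) (Fin.snoc (α := fun _ => U) b y i) := by
    intro n a b hab x y hxy i
    refine Fin.lastCases ?_ (fun i => ?_) i
    · simpa using hxy
    · simpa using hab i
  induction φ with
  | home => exact hφ.elim
  | @mem n m k C t =>
    cases h₁ with
    | mem _ C _ =>
    refine h₂.realize ?_
    have e : ∀ a : Fin n → U, (fun i => ((t i).subst (β' := Fin 0) (fun j =>
        (.var j : L.Term (Empty ⊕ Fin n))) fun j => .inr (η j)).realize
          (Sum.elim Empty.elim a) Fin.elim0) =
        fun i => (t i).realize (Sum.elim Empty.elim a) η := by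
      intro a
      funext i
      rw [STerm.realize_subst]
      rfl
    have := hR n k C (fun i => (t i).subst (β' := Fin 0) (fun j => .var j) fun j => .inr (η j))
      a b hab
    simp only [PosFormula.Holds, PosFormula.Realize, e] at this
    exact this ha
  | and φ ψ ih ih' =>
    cases h₁ with
    | and h₁ h₁' => cases h₂ with
      | and h₂ h₂' => exact ⟨ih h₁ h₂ hφ.1 hab ha.1, ih' h₁' h₂' hφ.2 hab ha.2⟩
  | or φ ψ ih ih' =>
    cases h₁ with
    | or h₁ h₁' => cases h₂ with
      | or h₂ h₂' => exact ha.imp (ih h₁ h₂ hφ.1 hab) (ih' h₁' h₂' hφ.2 hab)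
  | allH φ ih =>
    cases h₁ with
    | allH h₁ => cases h₂ with
      | allH h₂ =>
        by_contra hc
        obtain ⟨y, hy⟩ := not_forall.1 hc
        obtain ⟨y, hyB, hy⟩ := hB _ _
          ((h₂.isContinuous (h₁.isContinuous hφ)).cdef_realize η) b (fun i => hRB ▸ ⟨_, hab i⟩) y hy
        rw [← hRB] at hyB
        obtain ⟨x, hxy⟩ := hyB
        exact hy (ih h₁ h₂ hφ (hsnoc hab hxy) (ha x))
  | exH φ ih =>
    cases h₁ with
    | exH h₁ => cases h₂ with
      | exH h₂ =>
        -- The Tarski–Vaught test in `A` needs an open condition: `¬ χ` lies between `φ₁` and `ψ`,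
        -- so the witness found in `A` satisfies `ψ`.
        obtain ⟨ψ, h3, h4⟩ := h₂.exists_between
        obtain ⟨χ, hχ, h5⟩ := h3.exists_negation.{uf, ur, uF, us, uU} (h₁.isContinuous hφ)
        obtain ⟨x, hx⟩ := ha
        obtain ⟨x, hxA, hx⟩ := hA _ _ (hχ.cdef_realize η) a
          (fun i => hRA ▸ ⟨_, hab i⟩) x ((h5 U _ _ _).1 hx)
        rw [← hRA] at hxA
        obtain ⟨y, hxy⟩ := hxA
        exact ⟨y, ih (h₁.trans h3) h4 hφ (hsnoc hab hxy) ((h5 U _ _ _).2 hx)⟩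
  | allS φ ih =>
    cases h₁ with
    | allS h₁ => cases h₂ with
      | allS h₂ => exact fun s => ih h₁ h₂ hφ hab (ha s)
  | exS φ ih =>
    cases h₁ with
    | exS h₁ => cases h₂ with
      | exS h₂ => exact ha.imp fun s hs => ih h₁ h₂ hφ hab hs

/-- c-isomorphisms preserve continuous formulas. -/
theorem PreservesAtomic.holds (hU : PosSaturated L F S U (Order.succ ℵ₀)) {A B : Set U}
    (hA : TarskiVaught L F S A) (hB : TarskiVaught L F S B) {R : U → U → Prop}
    (hR : PreservesAtomic L F S R) (hRA : {a | ∃ b, R a b} = A) (hRB : {b | ∃ a, R a b} = B)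
    {n : ℕ} {φ : PosFormula L F S Empty n 0} (hφ : φ.IsContinuous)
    {a b : Fin n → U} (hab : ∀ i, R (a i) (b i)) (ha : φ.Holds U a) : φ.Holds U b := by
  by_contra hb
  obtain ⟨φ₂, h, hb₂⟩ := hU.exists_weakening_not_realize hφ hb
  obtain ⟨φ₁, h₁, h₂⟩ := h.exists_between
  exact hb₂ (hR.realize_of_weakening_of_weakening hA hB hRA hRB h₁ h₂ hφ hab (h₁.realize ha))

/-- Sequences of elements of `U`, with the topology whose closed sets are generated by the sets
definable by continuous formulas. -/
def SeqSpace (_L : FirstOrder.Language.{uf, ur}) (_F : ℕ → ℕ → Type uF) (_S : Type us)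
    (U : Type uU) : Type uU := ℕ → U

instance : TopologicalSpace (SeqSpace L F S U) :=
  .generateFrom {O : Set (ℕ → U) | CDef L F S Oᶜ}

namespace SeqSpace

omit [CompactSpace S] [T2Space S] in
theorem le_nhds_iff {f : Filter (SeqSpace L F S U)} {c : SeqSpace L F S U} :
    f ≤ 𝓝 c ↔ ∀ P : Set (ℕ → U), CDef L F S P → c ∉ P → Pᶜ ∈ f := by
  rw [TopologicalSpace.nhds_generateFrom]
  simp only [le_iInf_iff, Filter.le_principal_iff]
  constructor
  · intro h P hP hc
    exact h Pᶜ ⟨hc, hP.congr fun _ => not_not⟩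
  · rintro h O ⟨hc, hO⟩
    exact Filter.mem_of_superset (h Oᶜ hO fun h => h hc) fun x hx => not_not.1 hx

omit [CompactSpace S] [T2Space S] in
theorem isClosed_of_cdef {P : Set (ℕ → U)} (hP : CDef L F S P) :
    IsClosed (X := SeqSpace L F S U) P :=
  ⟨TopologicalSpace.isOpen_generateFrom_of_mem (hP.congr fun _ => not_not)⟩

omit [CompactSpace S] [T2Space S] in
-- Complements of definable sets form a base, because definable sets are closed under finite unions.
theorem exists_cdef_of_isOpen {O : Set (SeqSpace L F S U)} (hO : IsOpen O)
    {c : SeqSpace L F S U} (hc : c ∈ O) : ∃ P : Set (ℕ → U), CDef L F S P ∧ c ∉ P ∧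
      ∀ c', c' ∉ P → c' ∈ O := by
  induction hO with
  | basic O hO => exact ⟨Oᶜ, hO, fun h => h hc, fun c' hc' => not_not.1 hc'⟩
  | univ => exact ⟨∅, CDef.empty L F S, fun h => h, fun _ _ => trivial⟩
  | inter O O' _ _ ih ih' =>
    obtain ⟨P, hP, h1, h2⟩ := ih hc.1
    obtain ⟨P', hP', h1', h2'⟩ := ih' hc.2
    exact ⟨P ∪ P', hP.union hP', not_or.2 ⟨h1, h1'⟩, fun c' h =>
      ⟨h2 _ fun h' => h (.inl h'), h2' _ fun h' => h (.inr h')⟩⟩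
  | sUnion K _ ih =>
    obtain ⟨O, hO, hc⟩ := hc
    obtain ⟨P, hP, h1, h2⟩ := ih O hO hc
    exact ⟨P, hP, h1, fun c' h => ⟨O, hO, h2 c' h⟩⟩

/-- Sequences of the same type are inseparable, so Hausdorffness is not to be expected; sequences of
different types are separated by regularity. -/
theorem r1Space (hU : PosSaturated L F S U (Order.succ ℵ₀)) : R1Space (SeqSpace L F S U) := by
  refine ⟨fun x y => ?_⟩
  by_cases h : 𝓝 x ≤ 𝓝 y
  · exact .inl h
  · right
    rw [le_nhds_iff] at h
    push Not at h
    obtain ⟨P, hP, hy, hx⟩ := h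
    have hx' : x ∈ P := by
      by_contra hx'
      exact hx ((isClosed_of_cdef hP).isOpen_compl.mem_nhds hx')
    obtain ⟨Q, R, hQ, hR, hPQ, hQR, hyR⟩ := hP.exists_regular hU hy
    exact Filter.disjoint_iff.2 ⟨_, (isClosed_of_cdef hQ).isOpen_compl.mem_nhds (hPQ hx'), _,
      (isClosed_of_cdef hR).isOpen_compl.mem_nhds hyR,
      Set.disjoint_left.2 fun z hz hz' => hz' (hQR hz)⟩

omit [CompactSpace S] [T2Space S] in
-- The limit of an ultrafilter is built coordinate by coordinate: `good k v` says that `v` meets all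
-- definable conditions on the first `k` coordinates that the ultrafilter contains, and saturation
-- over `v` provides the next coordinate.
theorem compactSpace (hU : PosSaturated L F S U (Order.succ ℵ₀)) :
    CompactSpace (SeqSpace L F S U) := by
  refine ⟨isCompact_iff_ultrafilter_le_nhds.2 fun (f : Ultrafilter (ℕ → U)) _ => ?_⟩
  let good : ∀ k, (Fin k → U) → Prop := fun k v => ∀ P : Set (Fin k → U), CDef L F S P →
    {c : ℕ → U | (fun i : Fin k => c i) ∈ P} ∈ (f : Filter (ℕ → U)) → v ∈ P
  have hstep : ∀ k (v : {v // good k v}), ∃ w : {v // good (k + 1) v},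
      Fin.init (α := fun _ => U) w.1 = v.1 := by
    rintro k ⟨v, hv⟩
    let g : Fin (k + 1) → Fin k ⊕ Fin 1 := Fin.snoc (α := fun _ => Fin k ⊕ Fin 1) .inl (.inr 0)
    have hg : ∀ (x : Fin k → U) (z : Fin 1 → U),
        Sum.elim x z ∘ g = Fin.snoc (α := fun _ => U) x (z 0) := by
      intro x z
      funext i
      refine Fin.lastCases ?_ (fun i => ?_) i <;> simp [g]
    let J := {P : Set (Fin (k + 1) → U) // CDef L F S P ∧
      {c : ℕ → U | (fun i : Fin (k + 1) => c i) ∈ P} ∈ (f : Filter (ℕ → U))}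
    obtain ⟨z, hz⟩ := hU.exists_forall_mem v (fun P : J => P.2.1.comp g) (by
      intro t ht
      have hmem := (Filter.biInter_mem ht).2 fun (P : J) _ => P.2.2
      obtain ⟨z, hz⟩ := hv _ (CDef.biInter (fun P : J => P.2.1.comp g) ht).exists_right
        (Filter.mem_of_superset hmem fun c hc => ⟨fun _ => c k, mem_iInter₂.2 fun P hP => by
          change _ ∘ _ ∈ P.1
          rw [hg]
          have := mem_iInter₂.1 hc P hP
          refine mem_of_eq_of_mem ?_ this
          funext i
          refine Fin.lastCases ?_ (fun i => ?_) i <;> simp⟩)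
      exact ⟨z, fun P hP => mem_iInter₂.1 hz P hP⟩)
    refine ⟨⟨Fin.snoc (α := fun _ => U) v (z 0), fun P hP hPf => ?_⟩, by simp⟩
    rw [← hg]
    exact hz ⟨P, hP, hPf⟩
  choose nxt hnxt using hstep
  have h0 : good 0 Fin.elim0 := by
    intro P _ hPf
    obtain ⟨c, hc⟩ := f.nonempty_of_mem hPf
    rwa [Subsingleton.elim Fin.elim0 fun i : Fin 0 => c i]
  let t : ∀ k, {v // good k v} := fun k => Nat.rec ⟨_, h0⟩ nxt k
  let c : ℕ → U := fun k => (t (k + 1)).1 (Fin.last k)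
  have hc : ∀ k, (fun i : Fin k => c i) = (t k).1 := by
    intro k
    induction k with
    | zero => exact Subsingleton.elim _ _
    | succ k ih =>
      funext i
      refine Fin.lastCases rfl (fun i => ?_) i
      have h1 : (t k).1 i = (t (k + 1)).1 (Fin.castSucc i) := (congrFun (hnxt k (t k)) i).symm
      rw [← h1, ← ih]
      rfl
  refine ⟨c, trivial, le_nhds_iff.2 fun P hP hcP => ?_⟩
  by_contra hPf
  have hPf' : P ∈ (f : Filter (ℕ → U)) := by
    by_contra h
    exact hPf (Ultrafilter.compl_mem_iff_notMem.2 h)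
  obtain ⟨s, hs⟩ := hP.exists_support
  obtain ⟨k, hk⟩ : ∃ k, ∀ i ∈ s, i < k := ⟨s.sup id + 1, fun i hi =>
    Nat.lt_succ_of_le (Finset.le_sup (f := id) hi)⟩
  -- Coordinates from `k` on do not matter for `P`, so they are quantified out and the condition
  -- concerns the first `k` only.
  let g : ℕ → Fin k ⊕ ℕ := fun i => if h : i < k then .inl ⟨i, h⟩ else .inr i
  obtain ⟨z, hz⟩ := (t k).2 _ (hP.comp g).exists_right
    (Filter.mem_of_superset hPf' fun c hc => ⟨c, by
      change _ ∘ g ∈ P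
      refine mem_of_eq_of_mem ?_ hc
      funext i
      by_cases hi : i < k <;> simp [g, hi]⟩)
  refine hcP ((hs _ _ fun i hi => ?_).1 hz)
  have hik := hk i hi
  rw [← hc k]
  simp [g, hik]

end SeqSpace

end

end Omitting

/-! ### Baire category and omitting types. -/

section OmittingTypes

variable {L : FirstOrder.Language.{uf, ur}} {F : ℕ → ℕ → Type uF} {S : Type us}
  [UniformSpace S] [CompactSpace S] [T2Space S] {U : Type uU} [L.Structure U]
  [StandardStructure F S U]

open FirstOrder.Language (Term)

namespace SeqSpace

omit [CompactSpace S] [T2Space S] in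
-- By saturation the existence of `x` reduces to finite parts of `p`, which turns the set into an
-- intersection of definable ones.
theorem isClosed_exists_type (hU : PosSaturated L F S U (Order.succ ℵ₀)) {n : ℕ}
    {p : Set (PosFormula L F S Empty n 0)} (hp : ∀ φ ∈ p, φ.IsContinuous)
    {Q : Set (Fin n ⊕ Fin n → U)} (hQ : CDef L F S Q) (t : Fin n → L.Term ℕ) :
    IsClosed {c : SeqSpace L F S U | ∃ x, (∀ ψ ∈ p, ψ.Holds U x) ∧
      Sum.elim x (fun i => (t i).realize c) ∈ Q} := by
  let P : Option p → Set (Fin n ⊕ Fin n → U) := fun j =>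
    j.elim {w | w ∘ Sum.swap ∈ Q} fun ψ => {w | w ∘ Sum.inr ∈ {v | ψ.1.Holds U v}}
  have hP : ∀ j, CDef L F S (P j) := by
    rintro (_ | ψ)
    · exact hQ.comp Sum.swap
    · exact ((hp _ ψ.2).cdef_holds (U := U)).comp Sum.inr
  have hswap : ∀ x y : Fin n → U, Sum.elim y x ∘ Sum.swap = Sum.elim x y := by
    intro x y
    funext i
    rcases i with i | i <;> rfl
  have key : {c : ℕ → U | ∃ x, (∀ ψ ∈ p, ψ.Holds U x) ∧
      Sum.elim x (fun i => (t i).realize c) ∈ Q} = ⋂ T : {T : Set (Option p) // T.Finite},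
        {c : ℕ → U | (fun i => (t i).realize c) ∈
          {v : Fin n → U | ∃ z : Fin n → U, Sum.elim v z ∈ ⋂ j ∈ T.1, P j}} := by
    ext c
    rw [mem_iInter]
    constructor
    · rintro ⟨x, hx, hxQ⟩ T
      refine ⟨x, mem_iInter₂.2 ?_⟩
      rintro (_ | ψ) -
      · change _ ∘ _ ∈ Q
        rwa [hswap]
      · exact hx _ ψ.2
    · intro h
      obtain ⟨x, hx⟩ := hU.exists_forall_mem (fun i => (t i).realize c) hP fun T hT => by
        obtain ⟨z, hz⟩ := h ⟨T, hT⟩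
        exact ⟨z, fun j hj => mem_iInter₂.1 hz j hj⟩
      refine ⟨x, fun ψ hψ => hx (some ⟨ψ, hψ⟩), ?_⟩
      have := hx none
      change _ ∘ _ ∈ Q at this
      rwa [hswap] at this
  exact (congrArg (IsClosed (X := SeqSpace L F S U)) key).mpr <|
    isClosed_iInter (X := SeqSpace L F S U) fun T =>
      isClosed_of_cdef ((CDef.biInter hP T.2).exists_right.preimage t)

/-- If the closed set of sequences with `t(c)` close to a realization of `p` had interior, it would
contain a basic open `Pᶜ`. Being close to some `t(c)` with `c ∉ P` would then be an open condition,
met by a realization of `p`, all of whose points are `ε`-close to realizations, against `hε`. -/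
theorem eventually_residual_omits [UniformSpace U] [CompatibleUniformity L F S U]
    (hU : PosSaturated L F S U (Order.succ ℵ₀)) {n : ℕ}
    {p : Set (PosFormula L F S Empty n 0)} (hp : ∀ φ ∈ p, φ.IsContinuous)
    {ε : Entourage L F S n} (hε : ∀ φ : PosFormula L F S Empty n 0, φ.IsContinuous →
      (∃ a : Fin n → U, ¬ φ.Holds U a ∧ ∀ ψ ∈ p, ψ.Holds U a) →
        ∃ a : Fin n → U, ¬ φ.Holds U a ∧ ∀ a', (∀ ψ ∈ p, ψ.Holds U a') → ¬ ε.Rel a' a) :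
    ∃ V ∈ 𝓤 (Fin n → U), ∀ t : Fin n → L.Term ℕ,
      ∀ᶠ c : SeqSpace L F S U in residual (SeqSpace L F S U),
      ∀ x, (∀ ψ ∈ p, ψ.Holds U x) → (x, fun i => (t i).realize c) ∉ V := by
  obtain ⟨V, hV, hVs, hVε⟩ := comp_symm_mem_uniformity_sets (ε.rel_mem (U := U))
  obtain ⟨G, hG, hG𝓤, hGV⟩ := exists_cdef_compl_subset L F S hV
  obtain ⟨Q, hQ, hQ𝓤, hQV⟩ := exists_cdef_subset L F S (Filter.inter_mem hV hG𝓤)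
  refine ⟨_, hQ𝓤, fun t => ?_⟩
  have hcl := isClosed_exists_type (U := U) hU hp hQ t
  refine Filter.mem_of_superset (residual_of_dense_open hcl.isOpen_compl ?_)
    fun c hc x hx hxQ => hc ⟨x, hx, hxQ⟩
  rw [← interior_eq_empty_iff_dense_compl, eq_empty_iff_forall_notMem]
  intro c₀ hc₀
  obtain ⟨P, hP, hc₀P, hPO⟩ := exists_cdef_of_isOpen isOpen_interior hc₀
  let σ : Fin n ⊕ Fin n → L.Term (Fin n ⊕ ℕ) :=
    Sum.elim (fun i => .var (.inl i)) fun i => (t i).relabel .inr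
  have hσ : ∀ (a : Fin n → U) (c : ℕ → U), (fun i => (σ i).realize (Sum.elim a c)) =
      Sum.elim a fun i => (t i).realize c := by
    intro a c
    funext i
    rcases i with i | i
    · rfl
    · simp [σ]
  -- The negation of `θ` is the would-be isolating condition: some `c ∉ P` has `t(c)` close to `a`.
  obtain ⟨θ, hθ, hθP⟩ := ((hP.comp (ι' := Fin n ⊕ ℕ) .inr).union
    (hG.preimage σ)).forall_right.exists_formula
  have hθP' : ∀ a : Fin n → U, ¬ θ.Holds U a ↔
      ∃ c : ℕ → U, c ∉ P ∧ Sum.elim a (fun i => (t i).realize c) ∉ G := by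
    intro a
    rw [← hθP]
    simp only [mem_ofPred_eq, not_forall]
    refine exists_congr fun c => ?_
    rw [mem_union, not_or, ← hσ]
    rfl
  obtain ⟨x, hx, hxQ⟩ := interior_subset (X := SeqSpace L F S U) hc₀
  obtain ⟨a, ha, haε⟩ := hε θ hθ ⟨x, (hθP' x).2 ⟨c₀, hc₀P, (hQV _ _ hxQ).2⟩, hx⟩
  obtain ⟨c, hcP, hcG⟩ := (hθP' a).1 ha
  obtain ⟨x', hx', hx'Q⟩ := interior_subset (X := SeqSpace L F S U) (hPO c hcP)
  exact haε x' hx' (hVε (show (x', a) ∈ _ from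
    ⟨_, (hQV _ _ hx'Q).1, SetRel.symm V (hGV _ _ hcG)⟩))

omit [CompactSpace S] [T2Space S] in
-- A basic open set constrains finitely many coordinates, so whenever a witness exists it can be
-- written into an unused coordinate `j` that occurs neither in the constraint nor in `t`.
theorem eventually_residual_witness {n : ℕ} {Q : Set (Fin (n + 1) → U)} (hQ : CDef L F S Q)
    (t : Fin n → L.Term ℕ) : ∀ᶠ c : SeqSpace L F S U in residual (SeqSpace L F S U),
      (∃ b, Fin.snoc (α := fun _ => U) (fun i => (t i).realize c) b ∉ Q) →
        ∃ j, Fin.snoc (α := fun _ => U) (fun i => (t i).realize c) (c j) ∉ Q := by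
  classical
  have hsnoc : ∀ {ι : Type} (c : ι → U) (s : Fin n → L.Term ι) (j : ι),
      (fun i => (Fin.snoc (α := fun _ => L.Term ι) s (.var j) i).realize c) =
        Fin.snoc (α := fun _ => U) (fun i => (s i).realize c) (c j) := by
    intro ι c s j
    funext i
    refine Fin.lastCases ?_ (fun i => ?_) i <;> simp
  let K : Set (ℕ → U) := {c | ∀ b, Fin.snoc (α := fun _ => U) (fun i => (t i).realize c) b ∈ Q}
  let W : Set (ℕ → U) :=
    ⋃ j, {c | Fin.snoc (α := fun _ => U) (fun i => (t i).realize c) (c j) ∈ Q}ᶜ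
  have hW : IsOpen (X := SeqSpace L F S U) W := by
    refine isOpen_iUnion fun j => (isClosed_of_cdef ?_).isOpen_compl
    refine (hQ.preimage (Fin.snoc (α := fun _ => L.Term ℕ) t (.var j))).congr fun c => ?_
    simp only [mem_ofPred_eq, hsnoc]
  have hK : CDef L F S K := by
    refine (hQ.preimage (Fin.snoc (α := fun _ => L.Term (ℕ ⊕ Fin 1))
      (fun i => (t i).relabel .inl) (.var (.inr 0)))).forall_right.congr fun c => ?_
    have : ∀ z : Fin 1 → U, (fun i => Term.realize (Sum.elim c z)
        (Fin.snoc (α := fun _ => L.Term (ℕ ⊕ Fin 1)) (fun i => (t i).relabel .inl)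
          (.var (.inr 0)) i)) =
        Fin.snoc (α := fun _ => U) (fun i => (t i).realize c) (z 0) := by
      intro z
      rw [hsnoc]
      simp [Function.comp_def]
    simp only [mem_ofPred_eq, this, K]
    exact ⟨fun h z => h _, fun h b => h fun _ => b⟩
  have hd : Dense (X := SeqSpace L F S U) (interior (X := SeqSpace L F S U) K ∪ W) := by
    refine dense_iff_inter_open.2 fun O hO hne => ?_
    by_cases hOK : O ⊆ K
    · obtain ⟨c, hc⟩ := hne
      exact ⟨c, hc, .inl (interior_maximal (X := SeqSpace L F S U) hOK hO hc)⟩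
    · obtain ⟨c, hcO, hcK⟩ := not_subset.1 hOK
      obtain ⟨P, hP, hcP, hPO⟩ := exists_cdef_of_isOpen hO hcO
      obtain ⟨b, hb⟩ := not_forall.1 hcK
      obtain ⟨s, hs⟩ := hP.exists_support
      choose s' hs' using fun i => exists_term_support (M := U) (t i)
      obtain ⟨j, hj⟩ := Infinite.exists_notMem_finset (s ∪ Finset.univ.biUnion s')
      rw [Finset.mem_union, not_or] at hj
      let c' : ℕ → U := Function.update c j b
      have hc' : ∀ i, i ≠ j → c' i = c i := fun i hi => Function.update_of_ne hi _ _
      have h1 : c' ∉ P := fun h => hcP ((hs _ _ fun i hi => hc' i fun e => hj.1 (e ▸ hi)).1 h)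
      have h2 : (fun i => (t i).realize c') = fun i => (t i).realize c := by
        funext i
        refine hs' i _ _ fun k hk => hc' k fun e => hj.2 ?_
        exact Finset.mem_biUnion.2 ⟨i, Finset.mem_univ _, e ▸ hk⟩
      refine ⟨c', hPO _ h1, .inr (mem_iUnion.2 ⟨j, ?_⟩)⟩
      change ¬ Fin.snoc (α := fun _ => U) _ _ ∈ Q
      rw [h2, show c' j = b from Function.update_self _ _ _]
      exact hb
  refine Filter.mem_of_superset (residual_of_dense_open (isOpen_interior.union hW) hd) ?_
  rintro c (hc | hc) ⟨b, hb⟩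
  · exact (hb (interior_subset (X := SeqSpace L F S U) hc b)).elim
  · exact mem_iUnion.1 hc

end SeqSpace

/-- The omitting types theorem. -/
theorem exists_countable_isCModel_omitting [UniformSpace U] [CompatibleUniformity L F S U]
    [Countable (Σ n, L.Functions n)] [Nonempty U]
    (hU : PosSaturated L F S U (Order.succ ℵ₀)) (hsep : ContinuousSeparable L F S U) {n : ℕ}
    {p : Set (PosFormula L F S Empty n 0)} (hp : ∀ φ ∈ p, φ.IsContinuous)
    {ε : Entourage L F S n} (hε : ∀ φ : PosFormula L F S Empty n 0, φ.IsContinuous →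
      (∃ a : Fin n → U, ¬ φ.Holds U a ∧ ∀ ψ ∈ p, ψ.Holds U a) →
        ∃ a : Fin n → U, ¬ φ.Holds U a ∧ ∀ a', (∀ ψ ∈ p, ψ.Holds U a') → ¬ ε.Rel a' a) :
    ∃ N : L.Substructure U, Countable N ∧ IsCModel F S N ∧ ∃ V ∈ 𝓤 (Fin n → U),
      ∀ y : Fin n → U, (∀ i, y i ∈ N) → ∀ x, (∀ ψ ∈ p, ψ.Holds U x) → (x, y) ∉ V := by
  obtain ⟨H, hH, hHc, hHd⟩ := hsep.exists_countable_cdef hU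
  obtain ⟨V, hV, hVt⟩ := SeqSpace.eventually_residual_omits hU hp hε
  have := SeqSpace.r1Space (L := L) (F := F) (S := S) (U := U) hU
  have := SeqSpace.compactSpace (L := L) (F := F) (S := S) (U := U) hU
  have : Nonempty (SeqSpace L F S U) := inferInstanceAs (Nonempty (ℕ → U))
  have : ∀ m, Countable (H m) := fun m => (hH m).to_subtype
  have h1 : ∀ᶠ c : SeqSpace L F S U in residual (SeqSpace L F S U), ∀ t : Fin n → L.Term ℕ,
      ∀ x, (∀ ψ ∈ p, ψ.Holds U x) → (x, fun i => (t i).realize c) ∉ V :=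
    eventually_countable_forall.2 hVt
  have h2 : ∀ᶠ c : SeqSpace L F S U in residual (SeqSpace L F S U), ∀ m, ∀ Q : H (m + 1),
      ∀ t : Fin m → L.Term ℕ,
      (∃ b, Fin.snoc (α := fun _ => U) (fun i => (t i).realize c) b ∉ Q.1) →
        ∃ j, Fin.snoc (α := fun _ => U) (fun i => (t i).realize c) (c j) ∉ Q.1 :=
    eventually_countable_forall.2 fun m => eventually_countable_forall.2 fun Q =>
      eventually_countable_forall.2 fun t =>
        SeqSpace.eventually_residual_witness (hHc _ Q.1 Q.2) t
  obtain ⟨c, hc1, hc2⟩ := (dense_of_mem_residual (h1.and h2)).nonempty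
  -- All terms are needed, not only the entries of `c`, for closure under the function symbols.
  let N : L.Substructure U :=
    { carrier := range fun t : L.Term ℕ => t.realize c
      fun_mem := fun f x hx => by
        choose t ht using hx
        exact ⟨.func f t, by simp [Term.realize, ht]⟩ }
  have hterm : ∀ {m : ℕ} {y : Fin m → U}, (∀ i, y i ∈ (N : Set U)) →
      ∃ t : Fin m → L.Term ℕ, (fun i => (t i).realize c) = y := by
    intro m y hy
    choose t ht using hy
    exact ⟨t, funext ht⟩
  have hTV : TarskiVaught L F S (N : Set U) := by
    intro m P hP a ha b hb
    obtain ⟨Q, hQ, hPQ, hbQ⟩ := hHd _ P hP _ hb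
    obtain ⟨t, rfl⟩ := hterm ha
    obtain ⟨j, hj⟩ := hc2 m ⟨Q, hQ⟩ t ⟨b, hbQ⟩
    exact ⟨c j, ⟨.var j, rfl⟩, fun h => hj (hPQ h)⟩
  refine ⟨N, (countable_range _).to_subtype, hTV.isCModel, V, hV, fun y hy => ?_⟩
  obtain ⟨t, rfl⟩ := hterm hy
  exact hc1 t

theorem COmegaCategorical.approxCIsolated [UniformSpace U] [CompatibleUniformity L F S U]
    [Countable (Σ n, L.Functions n)] (hU : PosSaturated L F S U (Order.succ ℵ₀))
    (hsep : ContinuousSeparable L F S U) (hcat : COmegaCategorical L F S U) {n : ℕ}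
    {p : Set (PosFormula L F S Empty n 0)} (hp : ∀ φ ∈ p, φ.IsContinuous)
    (hcons : Consistent U p) : ApproxCIsolated U p := by
  intro ε
  obtain ⟨a, ha⟩ := hcons
  rcases isEmpty_or_nonempty U with hE | hne
  · exact ⟨.mem (k := 0) ⊥ Fin.elim0, by simp only [PosFormula.IsContinuous], ⟨a, fun h => h, ha⟩,
      fun b _ => ⟨a, by rw [Subsingleton.elim b a]; exact ε.rel_refl a, ha⟩⟩
  by_contra hε
  push Not at hε
  obtain ⟨M, hMc, hM, haM⟩ := exists_countable_isCModel hU hsep a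
  obtain ⟨N, hNc, hN, V, hV, hNV⟩ := exists_countable_isCModel_omitting hU hsep hp (ε := ε) (by
    intro φ hφ h
    obtain ⟨b, hb, hb'⟩ := hε φ hφ h
    refine ⟨b, hb, fun a' ha' hr => ?_⟩
    obtain ⟨ψ, hψ, hψ'⟩ := hb' a' hr
    exact hψ' (ha' ψ hψ))
  obtain ⟨R, hR, hRM, hRN⟩ := hcat M N hMc hNc hM hN
  rw [cauchyCompletion_eq_closure] at hRM hRN
  have hab : ∀ i, ∃ b, R (a i) b := fun i => by
    have : a i ∈ closure (M : Set U) := subset_closure (haM i)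
    rwa [← hRM] at this
  choose b hab using hab
  have hb : ∀ ψ ∈ p, ψ.Holds U b := fun ψ hψ =>
    hR.holds hU ((hM.tarskiVaught hU).closure hU) ((hN.tarskiVaught hU).closure hU) hRM hRN
      (hp ψ hψ) hab (ha ψ hψ)
  have hbN : b ∈ closure (Set.univ.pi fun _ => (N : Set U)) := by
    rw [closure_pi_set]
    intro i _
    rw [← hRN]
    exact ⟨_, hab i⟩
  obtain ⟨y, hyV, hy⟩ := UniformSpace.mem_closure_iff_ball.1 hbN hV
  exact hNV y (fun i => hy i (mem_univ i)) b hb hyV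

end OmittingTypes

end StdLogic

/-! ### The equivalence. -/

theorem mainTheorem9
    (L : FirstOrder.Language.{uf, ur}) [Countable (Σ n : ℕ, L.Functions n)]
    (F : ℕ → ℕ → Type uF)
    (S : Type us) [TopologicalSpace S] [CompactSpace S] [T2Space S]
    (U : Type uU) [L.Structure U] [StdLogic.StandardStructure F S U]
    (κ : Cardinal.{uU}) (hκ : Cardinal.aleph0 < κ) (hU : StdLogic.PosSaturated L F S U κ)
    (hsep : StdLogic.ContinuousSeparable L F S U) :
    StdLogic.COmegaCategorical L F S U ↔
      ∀ (n : ℕ) (p : Set (StdLogic.PosFormula L F S Empty n 0)),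
        (∀ φ ∈ p, φ.IsContinuous) → StdLogic.Consistent U p →
          StdLogic.ApproxCIsolated U p := by
  open StdLogic in
  let _ : UniformSpace S := uniformSpaceOfCompactR1
  -- Only saturation over countable parameter sets is used.
  have hU' : PosSaturated L F S U (Order.succ ℵ₀) := fun A hA =>
    hU A (hA.trans_le (Order.succ_le_of_lt hκ))
  let u : UniformSpace U := homeUniformity L F S U
  have hu : CompatibleUniformity L F S U := compatibleUniformity_homeUniformity
  refine ⟨fun hcat n p hp hcons => hcat.approxCIsolated hU' hsep hp hcons, fun hiso => ?_⟩
  have := isCountablyGenerated_uniformity hU' hsep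
  have := completeSpace_of_posSaturated hU'
  let _ : PseudoMetricSpace U := UniformSpace.pseudoMetricSpace U
  intro M N hMc hNc hM hN
  rw [cauchyCompletion_eq_closure, cauchyCompletion_eq_closure]
  exact cIsomorphic_closure hU' hiso (hM.tarskiVaught hU') (hN.tarskiVaught hU')
    (countable_coe_iff.1 hMc) (countable_coe_iff.1 hNc)
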